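/- For a field $k$ of characteristic $p>0$ and an integer $i\ge 0$, let $\Omega_k^i=\bigwedge^i_k\Omega^1_{k/\mathbf Z}$ be the space of absolute differential $i$-forms (with $\Omega_k^{-1}=0$), and for $y\in k^\times$ put $\operatorname{dlog}(y)=dy/y$. Let $H_p^{i+1}(k)$ be the cokernel of the additive map $\wp=1-C^{-1}:\Omega_k^i\to\Omega_k^i/d\Omega_k^{i-1}$, where $C^{-1}$ is the inverse Cartier operator; it is characterised by $$\wp\bigl(x\,\operatorname{dlog}(y_1)\wedge\cdots\wedge\operatorname{dlog}(y_i)\bigr)=(x-x^p)\,\operatorname{dlog}(y_1)\wedge\cdots\wedge\operatorname{dlog}(y_i)\ \bmod d\Omega_k^{i-1}\qquad(x\in k,\ y_j\in k^\times).$$ (Equivalently, $H_p^{i+1}(k)=H^1_{\text{ét}}(k,\Omega^i_{k,\log})$.) The $p$-dimension $\dim_p(k)\in\mathbf N\cup\{\infty\}$ is the smallest integer $d\ge 0$ such that $\Omega_k^{d+1}=0$ and $H_p^{d+1}(k')=0$ for every finite extension $k'/k$, or $\infty$ if there is no such integer. Let $p$ be a prime number, $K$ a field of characteristic $p$ equipped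 with a discrete valuation (that is, a valuation whose value group is infinite cyclic), and $\widehat K$ its completion. Then $$\dim_p(K)\ \ge\ \dim_p(\widehat K).$$ -/

import Mathlib

open scoped KaehlerDifferential

noncomputable section

/-- The `k`-vector space `Ω_k^i = ⋀^i Ω¹_{k/ℤ}` of absolute differential `i`-forms of `k`. -/
abbrev AbsForms (k : Type*) [Field k] (i : ℕ) : Type _ := ⋀[k]^i (Ω[k⁄ℤ])

/-- The logarithmic differential `dlog y = dy / y` of a unit `y`. -/
def dlog {k : Type*} [Field k] (y : kˣ) : Ω[k⁄ℤ] :=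
  ((y : k)⁻¹) • KaehlerDifferential.D ℤ k (y : k)

/-- The additive subgroup `d Ω_k^{i-1}` of `Ω_k^i`. Since `Ω_k^{i-1}` is additively generated by the
forms `x₁ dx₂ ∧ ⋯ ∧ dx_i`, the image of the exterior derivative is the additive subgroup generated
by the forms `dx₁ ∧ dx₂ ∧ ⋯ ∧ dx_i`. For `i = 0` it is zero, as `Ω_k^{-1} = 0`. -/
def exactForms (k : Type*) [Field k] : (i : ℕ) → AddSubgroup (AbsForms k i)
  | 0 => ⊥
  | (i + 1) => AddSubgroup.closure
      { ω | ∃ x : Fin (i + 1) → k,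
          ω = exteriorPower.ιMulti k (i + 1) (fun j => KaehlerDifferential.D ℤ k (x j)) }

/-- The additive subgroup of `Ω_k^i` generated by the forms
`(x - x ^ p) dlog y₁ ∧ ⋯ ∧ dlog y_i`. As `Ω_k^i` is additively generated by the forms
`x dlog y₁ ∧ ⋯ ∧ dlog y_i`, its image in `Ω_k^i / d Ω_k^{i-1}` is the image of the additive map
`℘ = 1 - C⁻¹ : Ω_k^i → Ω_k^i / d Ω_k^{i-1}`, which is characterised by
`x dlog y₁ ∧ ⋯ ∧ dlog y_i ↦ (x - x ^ p) dlog y₁ ∧ ⋯ ∧ dlog y_i mod d Ω_k^{i-1}`. -/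
def artinSchreierForms (p : ℕ) (k : Type*) [Field k] (i : ℕ) : AddSubgroup (AbsForms k i) :=
  AddSubgroup.closure
    { ω | ∃ (x : k) (y : Fin i → kˣ),
        ω = (x - x ^ p) • exteriorPower.ιMulti k i (fun j => dlog (y j)) }

/-- Kato's group `H_p^{i+1}(k)` of a field `k` of characteristic `p > 0` (note the shift of the
index): the cokernel of `℘ : Ω_k^i → Ω_k^i / d Ω_k^{i-1}`. -/
abbrev KatoH (p : ℕ) (k : Type*) [Field k] (i : ℕ) : Type _ :=
  AbsForms k i ⧸ (exactForms k i ⊔ artinSchreierForms p k i)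

/-- The `p`-dimension of a field `k` of characteristic `p > 0`: the smallest integer `d` such that
`Ω_k^{d+1} = 0` and `H_p^{d+1}(k') = 0` for every finite extension `k'` of `k`, and `∞` if there is
no such integer. (Every finite extension of `k` is isomorphic to one in the universe of `k`.) -/
def pDim.{u} (p : ℕ) (k : Type u) [Field k] : ℕ∞ :=
  sInf { n : ℕ∞ | ∃ d : ℕ, n = (d : ℕ∞) ∧ Subsingleton (AbsForms k (d + 1)) ∧
    ∀ (k' : Type u) [Field k'] [Algebra k k'] [FiniteDimensional k k'],
      Subsingleton (KatoH p k' d) }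

end

/-!
Let `𝕂` be the completion of `K`. The conditions that define `dim_p ≤ d` are shown to pass from `K`
to `𝕂`; only completeness, an ultrametric norm and the density of `K` are used.

If `Ω_K^{d+1} = 0`, then `K = K^p(b)` for a family `b` of at most `d` elements
(`exists_surjective_pExpand_of_subsingleton`). The subfield `𝕂^p(b)` of `𝕂` is a finite-dimensional,
hence closed, `𝕂^p`-subspace and contains `K`, so that `𝕂 = 𝕂^p(b)`
(`surjective_pExpand_of_denseRange`). Hence `Ω_𝕂^{d+1} = 0`. For a finite extension `L` of `𝕂` the
degree `[L : L^p] = [𝕂 : 𝕂^p]` is at most `p^d`. If it is smaller, then `Ω_L^d = 0` and there is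
nothing to prove. Otherwise `b` has `d` elements and is a `p`-basis of both `K` and `𝕂`.

On a field `F` with a `p`-basis `b` of size `d`, every `x` is uniquely a sum `∑_I a_I^p b^I` with
exponents `0 ≤ I_j < p`. In the coordinate with respect to `dlog b_1 ∧ ⋯ ∧ dlog b_d`, the Cartier
operator on `Ω_F^d` is the additive map `C : x ↦ a_0`: its kernel is the group of exact forms, and
it maps `x^p dlog y_1 ∧ ⋯ ∧ dlog y_d` to `x dlog y_1 ∧ ⋯ ∧ dlog y_d`. Therefore `H_p^{d+1}(F) = 0`
if and only if `1 - C` is surjective on `F` (`IsPBasis.subsingleton_katoH_iff`).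

Let `M` be the separable closure of `𝕂` in `L`. By Krasner's lemma `M = 𝕂(β)` with `β` algebraic
over `K`, so that `K' = K(β)` is dense in `M` and finite over `K`. The family `b` is a `p`-basis of
`K'` and of `M`, and `1 - C` is surjective on `K'`. An element of `M` is the sum of an element of
`K'` and some `ε` with `‖ε‖ < 1`; the series `h = ∑_k ε^(p^k)` satisfies `h = ε + h^p`, whence
`ε = (1 - C)(-h^p)`. So `1 - C` is surjective on `M` (`subsingleton_katoH_of_isSeparable`).

The purely inseparable extension `L / M` is a tower of extensions `N(β) / N` of degree `p` with
`β^p ∈ N`. There are `p`-bases `(β^p, c)` of `N` and `(β, c)` of `N(β)`, and the Cartier operator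
of `N(β)` vanishes on `⊕_{0 < i < p} N β^i` and agrees modulo this subspace with that of `N` on `N`.
Surjectivity of `1 - C` thus passes from `N` to `N(β)`
(`subsingleton_katoH_of_isPurelyInseparable`).
-/

open scoped KaehlerDifferential

noncomputable section

/-! ### `p`-bases -/

section PBasis

variable (p : ℕ)

/-- The field `F`, viewed as an algebra over itself through the Frobenius `x ↦ x ^ p`. Its dimension
is the degree `[F : F ^ p]`. -/
def FrobTwist (_p : ℕ) (F : Type*) : Type _ := F

instance (F : Type*) [Field F] : Field (FrobTwist p F) := inferInstanceAs (Field F)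

instance [Fact p.Prime] (F : Type*) [Field F] [CharP F p] : Algebra F (FrobTwist p F) :=
  (frobenius F p).toAlgebra

/-- The degree `[F : F ^ p]` does not change under finite field extensions. -/
theorem finrank_frobTwist_eq [Fact p.Prime] (K L : Type*) [Field K] [Field L] [CharP K p]
    [CharP L p] [Algebra K L] [FiniteDimensional K L] :
    Module.finrank L (FrobTwist p L) = Module.finrank K (FrobTwist p K) := by
  let : Algebra K (FrobTwist p L) := ((frobenius L p).comp (algebraMap K L)).toAlgebra
  have : IsScalarTower K L (FrobTwist p L) := IsScalarTower.of_algebraMap_eq fun _ => rfl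
  let : Algebra (FrobTwist p K) (FrobTwist p L) := inferInstanceAs (Algebra K L)
  have : IsScalarTower K (FrobTwist p K) (FrobTwist p L) :=
    IsScalarTower.of_algebraMap_eq fun x => ((algebraMap K L).map_frobenius p x).symm
  have h1 := Module.finrank_mul_finrank K L (FrobTwist p L)
  have h2 := Module.finrank_mul_finrank K (FrobTwist p K) (FrobTwist p L)
  have h3 : Module.finrank (FrobTwist p K) (FrobTwist p L) = Module.finrank K L := rfl
  have h4 : 0 < Module.finrank K L := Module.finrank_pos
  rw [h3, ← h1, mul_comm] at h2
  exact (Nat.eq_of_mul_eq_mul_left h4 h2).symm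

variable {F : Type*} [Field F] {n : ℕ}

/-- The map `(a_I) ↦ ∑_I a_I ^ p b ^ I`, where `b ^ I = ∏ b_j ^ I_j` runs over the monomials with
exponents `0 ≤ I_j < p`. -/
def pExpand (b : Fin n → F) (a : (Fin n → Fin p) → F) : F :=
  ∑ I, a I ^ p * ∏ j, b j ^ (I j : ℕ)

/-- A family `b` is a `p`-basis of `F` if every element of `F` is uniquely of the form
`∑_I a_I ^ p b ^ I`. -/
def IsPBasis (b : Fin n → F) : Prop := Function.Bijective (pExpand p b)

variable [Fact p.Prime]

lemma pExpand_single (b : Fin n → F) (I : Fin n → Fin p) (a : F) :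
    pExpand p b (Pi.single I a) = a ^ p * ∏ j, b j ^ (I j : ℕ) := by
  rw [pExpand, Finset.sum_eq_single I]
  · simp
  · intro J _ hJ
    simp [hJ, (Fact.out : p.Prime).ne_zero]
  · simp

/-- The reduction of an exponent vector modulo `p`. -/
def modExponent (m : Fin n → ℕ) : Fin n → Fin p :=
  fun j => ⟨m j % p, Nat.mod_lt _ (Fact.out : p.Prime).pos⟩

lemma pow_mul_monomial_eq (b : Fin n → F) (m : Fin n → ℕ) (a : F) :
    a ^ p * ∏ j, b j ^ m j =
      pExpand p b (Pi.single (modExponent p m) (a * ∏ j, b j ^ (m j / p))) := by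
  rw [pExpand_single, mul_pow, mul_assoc, ← Finset.prod_pow, ← Finset.prod_mul_distrib]
  congr 1
  refine Finset.prod_congr rfl fun j _ => ?_
  rw [← pow_mul, ← pow_add]
  congr 1
  exact (Nat.div_add_mod' (m j) p).symm

variable [CharP F p]

/-- `pExpand` as a linear map with respect to the Frobenius-twisted structure. -/
def pExpandₗ (b : Fin n → F) : ((Fin n → Fin p) → F) →ₗ[F] FrobTwist p F where
  toFun := pExpand p b
  map_add' x y := by
    change pExpand p b (x + y) = (pExpand p b x + pExpand p b y : F)
    simp only [pExpand, Pi.add_apply, add_pow_char, add_mul, Finset.sum_add_distrib]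
  map_smul' c x := by
    change pExpand p b (c • x) = (c ^ p * pExpand p b x : F)
    simp only [pExpand, Pi.smul_apply, smul_eq_mul, mul_pow, Finset.mul_sum, mul_assoc]

lemma pExpand_add (b : Fin n → F) (x y : (Fin n → Fin p) → F) :
    pExpand p b (x + y) = pExpand p b x + pExpand p b y := (pExpandₗ p b).map_add x y

lemma pExpand_smul (b : Fin n → F) (c : F) (x : (Fin n → Fin p) → F) :
    pExpand p b (c • x) = c ^ p * pExpand p b x := (pExpandₗ p b).map_smul c x

lemma pow_le_finrank_of_injective {b : Fin n → F} (hb : Function.Injective (pExpand p b))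
    (h : Module.finrank F (FrobTwist p F) ≠ 0) : p ^ n ≤ Module.finrank F (FrobTwist p F) := by
  have := Module.finite_of_finrank_pos (Nat.pos_of_ne_zero h)
  simpa using LinearMap.finrank_le_finrank_of_injective (f := pExpandₗ p b) hb

lemma finite_of_surjective_pExpand {b : Fin n → F} (hb : Function.Surjective (pExpand p b)) :
    Module.Finite F (FrobTwist p F) :=
  Module.Finite.of_surjective (pExpandₗ p b) hb

lemma finrank_ne_zero_of_surjective {b : Fin n → F} (hb : Function.Surjective (pExpand p b)) :
    Module.finrank F (FrobTwist p F) ≠ 0 := by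
  have := finite_of_surjective_pExpand p hb
  exact Module.finrank_pos.ne'

lemma finrank_le_of_surjective {b : Fin n → F} (hb : Function.Surjective (pExpand p b)) :
    Module.finrank F (FrobTwist p F) ≤ p ^ n := by
  have := finite_of_surjective_pExpand p hb
  have h := LinearMap.finrank_range_le (pExpandₗ p b)
  rwa [LinearMap.range_eq_top.2 hb, finrank_top, Module.finrank_fintype_fun_eq_card,
    Fintype.card_fun, Fintype.card_fin, Fintype.card_fin] at h

lemma IsPBasis.finrank_eq {b : Fin n → F} (hb : IsPBasis p b) :
    Module.finrank F (FrobTwist p F) = p ^ n := by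
  simpa using (LinearEquiv.ofBijective (pExpandₗ p b) hb).finrank_eq.symm

lemma isPBasis_of_surjective {b : Fin n → F} (hb : Function.Surjective (pExpand p b))
    (h : Module.finrank F (FrobTwist p F) = p ^ n) : IsPBasis p b := by
  have := finite_of_surjective_pExpand p hb
  refine ⟨?_, hb⟩
  exact (LinearMap.injective_iff_surjective_of_finrank_eq_finrank
    (f := pExpandₗ p b) (by simp [h])).2 hb

/-- The additive subgroup of all `∑_I a_I ^ p b ^ I`. -/
def pSpan (b : Fin n → F) : AddSubgroup F where
  carrier := Set.range (pExpand p b)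
  add_mem' := by
    rintro _ _ ⟨x, rfl⟩ ⟨y, rfl⟩
    exact ⟨x + y, pExpand_add p b x y⟩
  zero_mem' := ⟨0, (pExpandₗ p b).map_zero⟩
  neg_mem' := by
    rintro _ ⟨x, rfl⟩
    exact ⟨-x, (pExpandₗ p b).map_neg x⟩

lemma pow_mul_monomial_mem_pSpan (b : Fin n → F) (m : Fin n → ℕ) (a : F) :
    a ^ p * ∏ j, b j ^ m j ∈ pSpan p b :=
  ⟨_, (pow_mul_monomial_eq p b m a).symm⟩

lemma mul_mem_pSpan {b : Fin n → F} {x y : F} (hx : x ∈ pSpan p b) (hy : y ∈ pSpan p b) :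
    x * y ∈ pSpan p b := by
  obtain ⟨x, rfl⟩ := hx
  obtain ⟨y, rfl⟩ := hy
  rw [pExpand, pExpand, Finset.sum_mul_sum]
  refine sum_mem fun I _ => sum_mem fun J _ => ?_
  have := pow_mul_monomial_mem_pSpan p b (fun j => (I j : ℕ) + J j) (x I * y J)
  simp only [pow_add, Finset.prod_mul_distrib, mul_pow] at this
  rwa [mul_mul_mul_comm] at this

lemma pow_mem_pSpan (b : Fin n → F) (x : F) : x ^ p ∈ pSpan p b := by
  simpa using pow_mul_monomial_mem_pSpan p b 0 x

/-- The subfield `F ^ p (b_1, …, b_n)` of `F`, as the range of `pExpand`. -/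
def pRange (b : Fin n → F) : Subfield F where
  __ := pSpan p b
  one_mem' := by simpa using pow_mem_pSpan p b 1
  mul_mem' := mul_mem_pSpan p
  inv_mem' := by
    intro x hx
    have hpow : ∀ k : ℕ, x ^ k ∈ pSpan p b := by
      intro k
      induction k with
      | zero => simpa using pow_mem_pSpan p b 1
      | succ k ih => exact pow_succ x k ▸ mul_mem_pSpan p ih hx
    have h3 : x⁻¹ = x⁻¹ ^ p * x ^ (p - 1) := by
      by_cases h0 : x = 0
      · simp [h0, (Fact.out : p.Prime).ne_zero]
      · rw [inv_pow, pow_sub₀ _ h0 (Fact.out : p.Prime).one_le, pow_one,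
          inv_mul_cancel_left₀ (pow_ne_zero _ h0)]
    have := mul_mem_pSpan p (pow_mem_pSpan p b x⁻¹) (hpow (p - 1))
    rwa [← h3] at this

lemma pRange_eq_top {b : Fin n → F} : pRange p b = ⊤ ↔ Function.Surjective (pExpand p b) := by
  rw [eq_top_iff]
  exact ⟨fun h x => h (Subfield.mem_top x), fun h x _ => h x⟩

lemma pow_mem_pRange (b : Fin n → F) (x : F) : x ^ p ∈ pRange p b := pow_mem_pSpan p b x

lemma self_mem_pRange (b : Fin n → F) (j : Fin n) : b j ∈ pRange p b := by
  have := pow_mul_monomial_mem_pSpan p b (Pi.single j 1) 1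
  rw [one_pow, one_mul, Finset.prod_eq_single j (by intro k _ hk; simp [hk]) (by simp)] at this
  rw [Pi.single_eq_same, pow_one] at this
  exact this

lemma pRange_le {b : Fin n → F} {E : Subfield F} (hE : ∀ x, x ^ p ∈ E) (hb : ∀ j, b j ∈ E) :
    pRange p b ≤ E := by
  rintro _ ⟨a, rfl⟩
  exact sum_mem fun I _ => mul_mem (hE _) (prod_mem fun j _ => pow_mem (hb j) _)

omit [Fact p.Prime] [CharP F p] in
lemma pExpand_cons (y : F) (c : Fin n → F) (a : (Fin (n + 1) → Fin p) → F) :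
    pExpand p (Fin.cons y c : Fin (n + 1) → F) a =
      ∑ i : Fin p, pExpand p c (fun I => a (Fin.cons i I)) * y ^ (i : ℕ) := by
  rw [pExpand, ← (Fin.consEquiv (fun _ => Fin p)).sum_comp, Fintype.sum_prod_type]
  refine Finset.sum_congr rfl fun i _ => ?_
  rw [pExpand, Finset.sum_mul]
  refine Finset.sum_congr rfl fun I _ => ?_
  simp only [Fin.consEquiv, Equiv.coe_fn_mk, Fin.prod_univ_succ, Fin.cons_zero, Fin.cons_succ]
  ring

lemma natDegree_minpoly_of_notMem {E : Subfield F} (hE : ∀ x : F, x ^ p ∈ E) {y : F} (hy : y ∉ E) :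
    (minpoly E y).natDegree = p := by
  have hirr : Irreducible (Polynomial.X ^ p - Polynomial.C (⟨y ^ p, hE y⟩ : E)) := by
    refine X_pow_sub_C_irreducible_of_prime Fact.out fun z hz => hy ?_
    have : (z : F) ^ p = y ^ p := congrArg Subtype.val hz
    rw [← frobenius_inj F p this]
    exact z.2
  have hmin := minpoly.eq_of_irreducible_of_monic (x := y) hirr
    (by simp [Subfield.algebraMap_ofSubfield])
    (Polynomial.monic_X_pow_sub_C _ (Fact.out : p.Prime).ne_zero)
  rw [← hmin, Polynomial.natDegree_X_pow_sub_C]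

lemma linearIndependent_pow_of_notMem {E : Subfield F} (hE : ∀ x : F, x ^ p ∈ E) {y : F}
    (hy : y ∉ E) : LinearIndependent E (fun i : Fin p => y ^ (i : ℕ)) := by
  have := linearIndependent_pow (K := E) y
  rw [natDegree_minpoly_of_notMem p hE hy] at this
  exact this

lemma injective_pExpand_cons {y : F} {c : Fin n → F} (hc : Function.Injective (pExpand p c))
    (hy : y ∉ pRange p c) : Function.Injective (pExpand p (Fin.cons y c : Fin (n + 1) → F)) := by
  refine (injective_iff_map_eq_zero (pExpandₗ p (Fin.cons y c : Fin (n + 1) → F))).2 fun a ha => ?_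
  have ha' : ∑ i : Fin p, pExpand p c (fun I => a (Fin.cons i I)) * y ^ (i : ℕ) = 0 := by
    rw [← pExpand_cons]; exact ha
  have hli := linearIndependent_pow_of_notMem p (E := pRange p c) (pow_mem_pRange p c) hy
  have := Fintype.linearIndependent_iff.1 hli
    (fun i => ⟨pExpand p c (fun I => a (Fin.cons i I)), _, rfl⟩) ha'
  ext J
  have h1 : pExpand p c (fun I => a (Fin.cons (J 0) I)) = 0 := congrArg Subtype.val (this (J 0))
  have h2 : (fun I => a (Fin.cons (J 0) I)) = 0 :=
    hc (h1.trans (pExpandₗ p c).map_zero.symm)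
  have h3 := congrFun h2 (fun j => J j.succ)
  have h4 : (Fin.cons (J 0) (fun j => J j.succ) : Fin (n + 1) → Fin p) = J := Fin.cons_self_tail J
  rw [h4] at h3
  exact h3

/-- A subfield `E` with `F ^ p ⊆ E ⊆ F`, where `[F : F ^ p]` is finite, has a `p`-basis relative to
`F ^ p`. -/
theorem exists_relative_pBasis (h : Module.finrank F (FrobTwist p F) ≠ 0) (E : Subfield F)
    (hE : ∀ x : F, x ^ p ∈ E) :
    ∃ (n : ℕ) (c : Fin n → F), (∀ j, c j ∈ E) ∧ Function.Injective (pExpand p c) ∧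
      pRange p c = E := by
  classical
  let P : ℕ → Prop := fun n => ∃ c : Fin n → F, (∀ j, c j ∈ E) ∧ Function.Injective (pExpand p c)
  have hbound : ∀ n, P n → n ≤ Module.finrank F (FrobTwist p F) := fun n ⟨c, _, hc⟩ =>
    ((Nat.lt_pow_self (Fact.out : p.Prime).one_lt).le).trans (pow_le_finrank_of_injective p hc h)
  have h0 : P 0 := by
    refine ⟨Fin.elim0, fun j => j.elim0, fun x y hxy => ?_⟩
    ext I
    have e : ∀ x, pExpand p (Fin.elim0 : Fin 0 → F) x = x I ^ p := fun x => by
      rw [pExpand, Fintype.sum_subsingleton _ I, Finset.univ_eq_empty, Finset.prod_empty, mul_one]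
    exact frobenius_inj F p ((e x).symm.trans (hxy.trans (e y)))
  obtain ⟨c, hcE, hc⟩ := Nat.findGreatest_spec (P := P) (Nat.zero_le _) h0
  refine ⟨_, c, hcE, hc, le_antisymm (pRange_le p hE hcE) fun y hy => ?_⟩
  by_contra hyc
  have h1 : P (Nat.findGreatest P (Module.finrank F (FrobTwist p F)) + 1) :=
    ⟨Fin.cons y c, fun j => Fin.cases hy hcE j, injective_pExpand_cons p hc hyc⟩
  have := Nat.le_findGreatest (hbound _ h1) h1
  omega

theorem exists_isPBasis (h : Module.finrank F (FrobTwist p F) ≠ 0) :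
    ∃ (n : ℕ) (b : Fin n → F), IsPBasis p b := by
  obtain ⟨n, c, _, hc, htop⟩ := exists_relative_pBasis p h ⊤ fun _ => Subfield.mem_top _
  exact ⟨n, c, hc, (pRange_eq_top p).1 htop⟩

end PBasis

/-! ### Differentials and `p`-bases -/

section Differentials

variable (p : ℕ) [Fact p.Prime] {F : Type*} [Field F] [CharP F p] {n : ℕ}

omit [Fact p.Prime] in
lemma D_pow_char (x : F) : KaehlerDifferential.D ℤ F (x ^ p) = 0 := by
  rw [Derivation.leibniz_pow, ← Nat.cast_smul_eq_nsmul F, CharP.cast_eq_zero, zero_smul]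

omit [Fact p.Prime] in
lemma D_pow_char_mul (x y : F) : KaehlerDifferential.D ℤ F (x ^ p * y) =
    x ^ p • KaehlerDifferential.D ℤ F y := by
  rw [Derivation.leibniz, D_pow_char, smul_zero, add_zero]

/-- The subfield of all `x` whose differential lies in a given subspace of `Ω¹`. -/
def derivSubfield (W : Submodule F (Ω[F⁄ℤ])) : Subfield F where
  carrier := {x | KaehlerDifferential.D ℤ F x ∈ W}
  add_mem' {x y} hx hy := by
    simpa only [Set.mem_ofPred_eq, map_add] using W.add_mem hx hy
  mul_mem' {x y} hx hy := by
    simpa only [Set.mem_ofPred_eq, Derivation.leibniz] using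
      W.add_mem (W.smul_mem x hy) (W.smul_mem y hx)
  zero_mem' := by simp
  one_mem' := by simp
  neg_mem' {x} hx := by simpa using hx
  inv_mem' x hx := by
    simpa only [Set.mem_ofPred_eq, Derivation.leibniz_inv] using W.smul_mem _ hx

theorem span_D_eq_top {b : Fin n → F} (hb : Function.Surjective (pExpand p b)) :
    Submodule.span F (Set.range fun j => KaehlerDifferential.D ℤ F (b j)) = ⊤ := by
  set W := Submodule.span F (Set.range fun j => KaehlerDifferential.D ℤ F (b j)) with hW
  have h : pRange p b ≤ derivSubfield W := by
    refine pRange_le p (fun x => ?_) fun j => ?_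
    · change KaehlerDifferential.D ℤ F (x ^ p) ∈ W
      rw [D_pow_char p]
      exact W.zero_mem
    · exact Submodule.subset_span ⟨j, rfl⟩
  rw [eq_top_iff, ← KaehlerDifferential.span_range_derivation, Submodule.span_le]
  rintro _ ⟨x, rfl⟩
  exact h (hb x)

/-- A subfield of `F` that contains `F ^ p` and does not contain `x` is contained in a maximal
subfield with this property. -/
lemma exists_maximal_subfield (E : Subfield F) (x : F) (hx : x ∉ E) :
    ∃ E' : Subfield F, E ≤ E' ∧ Maximal (fun E' : Subfield F => E ≤ E' ∧ x ∉ E') E' := by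
  obtain ⟨m, hm, hmax⟩ := zorn_le_nonempty₀ {E' : Subfield F | E ≤ E' ∧ x ∉ E'} (by
    intro c hc hchain y hy
    refine ⟨sSup c, ⟨(hc hy).1.trans (le_sSup hy), fun hxc => ?_⟩, fun z hz => le_sSup hz⟩
    obtain ⟨z, hz, hxz⟩ := (Subfield.mem_sSup_of_directedOn ⟨y, hy⟩ hchain.directedOn).1 hxc
    exact (hc hz).2 hxz) E ⟨le_rfl, hx⟩
  exact ⟨m, hm, hmax⟩

/-- If the differentials of `b` span `Ω¹`, then `F = F ^ p (b)`. Otherwise `F` would have a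
subfield `E' ⊇ F ^ p (b)` over which it is purely inseparable of degree `p`; as `Ω¹_{F/E'} = 0`,
the extension `F / E'` would also be separable. -/
theorem surjective_pExpand_of_span_D {b : Fin n → F}
    (hb : Submodule.span F (Set.range fun j => KaehlerDifferential.D ℤ F (b j)) = ⊤) :
    Function.Surjective (pExpand p b) := by
  rw [← pRange_eq_top, eq_top_iff]
  intro x _
  by_contra hx
  obtain ⟨E, hle, hmax⟩ := exists_maximal_subfield (pRange p b) x hx
  have hxE : x ∉ E := hmax.prop.2
  have hE : ∀ y : F, y ^ p ∈ E := fun y => hle (pow_mem_pRange p b y)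
  have hint : ∀ y : F, IsIntegral E y := fun y =>
    IsIntegral.of_pow (Fact.out : p.Prime).pos (isIntegral_algebraMap (x := (⟨y ^ p, hE y⟩ : E)))
  -- by maximality `x ∈ E(y)` for every `y ∉ E`, and both `E(x)` and `E(y)` have degree `p` over `E`
  have htop : IntermediateField.adjoin E {x} = ⊤ := by
    rw [eq_top_iff]
    intro y _
    by_cases hy : y ∈ E
    · exact (IntermediateField.adjoin E {x}).algebraMap_mem ⟨y, hy⟩
    have hxy : x ∈ IntermediateField.adjoin E {y} := by
      by_contra hxy
      have h1 : E ≤ (IntermediateField.adjoin E {y}).toSubfield := fun z hz =>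
        (IntermediateField.adjoin E {y}).algebraMap_mem ⟨z, hz⟩
      exact hy (hmax.le_of_ge ⟨hle.trans h1, hxy⟩ h1
        (IntermediateField.mem_adjoin_simple_self E y))
    have hfd : FiniteDimensional E (IntermediateField.adjoin E {y}) :=
      IntermediateField.adjoin.finiteDimensional (hint y)
    have := IntermediateField.eq_of_le_of_finrank_eq
      (IntermediateField.adjoin_simple_le_iff.2 hxy) (by
        rw [IntermediateField.adjoin.finrank (hint x), IntermediateField.adjoin.finrank (hint y),
          natDegree_minpoly_of_notMem p hE hxE, natDegree_minpoly_of_notMem p hE hy])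
    rw [this]
    exact IntermediateField.mem_adjoin_simple_self E y
  have hfin : FiniteDimensional E F := by
    have h1 := IntermediateField.adjoin.finiteDimensional (hint x)
    rw [htop] at h1
    exact Module.Finite.equiv IntermediateField.topEquiv.toLinearEquiv
  have hD : ∀ z, KaehlerDifferential.D E F z = 0 := by
    intro z
    have h1 : KaehlerDifferential.D ℤ F z ∈
        LinearMap.ker (KaehlerDifferential.map ℤ E F F) := by
      have h2 : (⊤ : Submodule F (Ω[F⁄ℤ])) ≤
          LinearMap.ker (KaehlerDifferential.map ℤ E F F) := by
        rw [← hb, Submodule.span_le]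
        rintro _ ⟨j, rfl⟩
        change KaehlerDifferential.map ℤ E F F _ = 0
        rw [KaehlerDifferential.map_D]
        exact (KaehlerDifferential.D E F).map_algebraMap
          (⟨b j, hle (self_mem_pRange p b j)⟩ : E)
      exact h2 trivial
    rw [LinearMap.mem_ker, KaehlerDifferential.map_D] at h1
    exact h1
  have hsub : Subsingleton (Ω[F⁄E]) := by
    rw [← Submodule.subsingleton_iff F, ← subsingleton_iff_bot_eq_top,
      ← KaehlerDifferential.span_range_derivation, eq_comm, Submodule.span_eq_bot]
    rintro _ ⟨z, rfl⟩
    exact hD z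
  have hunr : Algebra.FormallyUnramified E F := ⟨hsub⟩
  have hchar : CharP E p := (algebraMap E F).charP (algebraMap E F).injective p
  have hexp : ExpChar E p := ExpChar.prime Fact.out
  have hpi : IsPurelyInseparable E F := (isPurelyInseparable_iff_pow_mem E p).2 fun y =>
    ⟨1, by rw [pow_one]; exact ⟨⟨y ^ p, hE y⟩, rfl⟩⟩
  have h := Algebra.FormallyUnramified.range_eq_top_of_isPurelyInseparable E F
  obtain ⟨z, hz⟩ : x ∈ (algebraMap E F).range := h ▸ trivial
  exact hxE (hz ▸ z.2)

/-- A family of `m` elements generating `F` over `F ^ p`, where `m = dim Ω¹`. -/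
lemma exists_surjective_pExpand_finrank [Module.Finite F (Ω[F⁄ℤ])] :
    ∃ b : Fin (Module.finrank F (Ω[F⁄ℤ])) → F, Function.Surjective (pExpand p b) := by
  have htop := KaehlerDifferential.span_range_derivation ℤ F
  have hfin : Module.Finite F (Submodule.span F (Set.range (KaehlerDifferential.D ℤ F))) := by
    infer_instance
  obtain ⟨f, hf, hspan, -⟩ := Submodule.exists_fun_fin_finrank_span_eq F
    (Set.range (KaehlerDifferential.D ℤ F))
  replace hspan := hspan.trans htop
  have e : Module.finrank F (Submodule.span F (Set.range (KaehlerDifferential.D ℤ F))) =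
      Module.finrank F (Ω[F⁄ℤ]) := by rw [htop, finrank_top]
  choose b hb using hf
  rw [← e]
  refine ⟨b, surjective_pExpand_of_span_D p ?_⟩
  rw [← hspan]
  congr 2
  exact funext hb

/-- `d + 1` linearly independent one-forms would have a nonzero wedge product. -/
theorem finite_and_finrank_le_of_subsingleton (d : ℕ) [Subsingleton (AbsForms F (d + 1))] :
    Module.Finite F (Ω[F⁄ℤ]) ∧ Module.finrank F (Ω[F⁄ℤ]) ≤ d := by
  have h : Module.rank F (Ω[F⁄ℤ]) ≤ d := by
    refine rank_le fun s hs => ?_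
    by_contra! hd
    have hw : LinearIndependent F fun i : Fin (d + 1) =>
        ((s.equivFin.symm (Fin.castLE hd i) : s) : Ω[F⁄ℤ]) :=
      hs.comp _ (s.equivFin.symm.injective.comp (Fin.castLE_injective hd))
    have h1 := exteriorPower.ιMulti_family_linearIndependent_field (n := d + 1) hw
    exact h1.ne_zero ⟨Finset.univ, by simp⟩ (Subsingleton.elim _ _)
  have h1 := Module.rank_lt_aleph0_iff.1 (h.trans_lt Cardinal.natCast_lt_aleph0)
  exact ⟨h1, Module.finrank_le_of_rank_le h⟩

theorem exists_surjective_pExpand_of_subsingleton (d : ℕ) [Subsingleton (AbsForms F (d + 1))] :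
    ∃ e ≤ d, ∃ b : Fin e → F, Function.Surjective (pExpand p b) := by
  obtain ⟨h1, h2⟩ := finite_and_finrank_le_of_subsingleton (F := F) d
  exact ⟨_, h2, exists_surjective_pExpand_finrank p⟩

lemma finite_kaehler_of_surjective {b : Fin n → F} (hb : Function.Surjective (pExpand p b)) :
    Module.Finite F (Ω[F⁄ℤ]) :=
  ⟨⟨(Set.finite_range _).toFinset, by rw [Set.Finite.coe_toFinset]; exact span_D_eq_top p hb⟩⟩

lemma finrank_kaehler_le {b : Fin n → F} (hb : Function.Surjective (pExpand p b)) :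
    Module.finrank F (Ω[F⁄ℤ]) ≤ n := by
  rw [← finrank_top, ← span_D_eq_top p hb]
  exact (finrank_range_le_card _).trans (Fintype.card_fin n).le

theorem subsingleton_absForms {b : Fin n → F} (hb : Function.Surjective (pExpand p b)) {m : ℕ}
    (hm : n < m) : Subsingleton (AbsForms F m) := by
  have := finite_kaehler_of_surjective p hb
  refine Module.finrank_zero_iff (R := F).1 ?_
  rw [exteriorPower.finrank_eq, Nat.choose_eq_zero_of_lt ((finrank_kaehler_le p hb).trans_lt hm)]

theorem IsPBasis.finrank_kaehler {b : Fin n → F} (hb : IsPBasis p b) :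
    Module.finrank F (Ω[F⁄ℤ]) = n := by
  refine le_antisymm (finrank_kaehler_le p hb.2) ?_
  have := finite_kaehler_of_surjective p hb.2
  obtain ⟨c, hc⟩ := exists_surjective_pExpand_finrank (F := F) p
  have := finrank_le_of_surjective p hc
  rw [hb.finrank_eq] at this
  exact (Nat.pow_le_pow_iff_right (Fact.out : p.Prime).one_lt).1 this

lemma IsPBasis.ne_zero {b : Fin n → F} (hb : IsPBasis p b) (j : Fin n) : b j ≠ 0 := by
  intro h0
  have h1 := pow_mul_monomial_eq p b (Pi.single j 1) 1
  have h2 : ∏ k, b k ^ (Pi.single j 1 : Fin n → ℕ) k = 0 :=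
    Finset.prod_eq_zero (Finset.mem_univ j) (by simp [h0])
  have h3 : ∏ k, b k ^ ((Pi.single j 1 : Fin n → ℕ) k / p) = 1 := by
    refine Finset.prod_eq_one fun k _ => ?_
    rw [Nat.div_eq_of_lt, pow_zero]
    rcases eq_or_ne k j with rfl | hk
    · simpa using (Fact.out : p.Prime).one_lt
    · simpa [hk] using (Fact.out : p.Prime).pos
  rw [h2, h3, mul_zero, mul_one] at h1
  have h4 := hb.1 (h1.symm.trans (pExpandₗ p b).map_zero.symm)
  have h5 := congrFun h4 (modExponent p (Pi.single j 1))
  simp at h5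

/-- The elements of a `p`-basis, as units. -/
def IsPBasis.unit {b : Fin n → F} (hb : IsPBasis p b) (j : Fin n) : Fˣ :=
  Units.mk0 (b j) (hb.ne_zero p j)

lemma IsPBasis.D_eq_smul_dlog {b : Fin n → F} (hb : IsPBasis p b) (j : Fin n) :
    KaehlerDifferential.D ℤ F (b j) = b j • dlog (hb.unit p j) := by
  rw [dlog, smul_smul]
  simp [IsPBasis.unit, hb.ne_zero p j]

/-- The logarithmic differentials of a `p`-basis form a basis of `Ω¹`. -/
def IsPBasis.dlogBasis {b : Fin n → F} (hb : IsPBasis p b) : Module.Basis (Fin n) F (Ω[F⁄ℤ]) :=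
  basisOfTopLeSpanOfCardEqFinrank (fun j => dlog (hb.unit p j)) (by
    rw [← span_D_eq_top p hb.2, Submodule.span_le]
    rintro _ ⟨j, rfl⟩
    simp only [hb.D_eq_smul_dlog p]
    exact Submodule.smul_mem _ _ (Submodule.subset_span ⟨j, rfl⟩))
    (by rw [Fintype.card_fin, hb.finrank_kaehler])

@[simp]
lemma IsPBasis.dlogBasis_apply {b : Fin n → F} (hb : IsPBasis p b) (j : Fin n) :
    hb.dlogBasis p j = dlog (hb.unit p j) := by
  simp [IsPBasis.dlogBasis]

end Differentials

/-! ### Exact forms and the inverse Cartier operator on one-forms -/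

section ExactForms

variable {F : Type*} [Field F] {n : ℕ}

/-- The forms `du ∧ ⋀_{k ≠ j} dlog y_k` are exact: up to terms killed by the `dy_k`, they are the
differentials of `u ∏_{k ≠ j} y_k⁻¹`, wedged with the `dy_k`. -/
lemma ιMulti_update_D_mem_exactForms (u : F) (y : Fin n → Fˣ) (j : Fin n) :
    exteriorPower.ιMulti F n
      (Function.update (fun k => dlog (y k)) j (KaehlerDifferential.D ℤ F u)) ∈
      exactForms F n := by
  obtain _ | n := n
  · exact j.elim0
  set w : Fin (n + 1) → F := Function.update (fun k => ((y k : F))⁻¹) j 1 with hw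
  set c : F := ∏ k, w k with hc
  set Dy : Fin (n + 1) → Ω[F⁄ℤ] := fun k => KaehlerDifferential.D ℤ F (y k : F) with hDy
  have h1 : Function.update (fun k => dlog (y k)) j (KaehlerDifferential.D ℤ F u) =
      fun k => w k • Function.update Dy j (KaehlerDifferential.D ℤ F u) k := by
    ext k
    rcases eq_or_ne k j with rfl | hk
    · simp [hw]
    · simp [hw, hk, hDy, dlog]
  -- the differential of `c` is a combination of the `dy_k` with `k ≠ j`
  let W : Submodule F (Ω[F⁄ℤ]) := Submodule.span F (Dy '' {j}ᶜ)
  have hcW : c ∈ derivSubfield W := by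
    refine prod_mem fun k _ => ?_
    rcases eq_or_ne k j with rfl | hk
    · rw [hw, Function.update_self]
      exact one_mem _
    · rw [hw, Function.update_of_ne hk]
      exact inv_mem (show (y k : F) ∈ derivSubfield W from
        Submodule.subset_span ⟨k, hk, rfl⟩)
  have hzero : ∀ ω ∈ W, exteriorPower.ιMulti F (n + 1) (Function.update Dy j ω) = 0 := by
    intro ω hω
    induction hω using Submodule.span_induction with
    | mem ω h =>
      obtain ⟨k, hk, rfl⟩ := h
      exact (exteriorPower.ιMulti F (n + 1)).map_update_self Dy (Ne.symm hk)
    | zero => exact (exteriorPower.ιMulti F (n + 1)).map_update_zero Dy j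
    | add a b _ _ ha hb => rw [AlternatingMap.map_update_add, ha, hb, add_zero]
    | smul a b _ hb => rw [AlternatingMap.map_update_smul, hb, smul_zero]
  have h2 : exteriorPower.ιMulti F (n + 1)
      (Function.update (fun k => dlog (y k)) j (KaehlerDifferential.D ℤ F u)) =
      exteriorPower.ιMulti F (n + 1)
        (Function.update Dy j (KaehlerDifferential.D ℤ F (u * c))) := by
    rw [h1, AlternatingMap.map_smul_univ, Derivation.leibniz, AlternatingMap.map_update_add,
      AlternatingMap.map_update_smul, AlternatingMap.map_update_smul, hzero _ hcW, smul_zero,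
      zero_add]
  rw [h2]
  refine AddSubgroup.subset_closure ⟨Function.update (fun k => (y k : F)) j (u * c), ?_⟩
  congr 1
  ext k
  rcases eq_or_ne k j with rfl | hk
  · simp
  · simp [hk, hDy]

variable (p : ℕ) [Fact p.Prime] [CharP F p]

omit [Fact p.Prime] in
lemma D_monomial (y : Fin n → Fˣ) (m : Fin n → ℕ) (a : F) :
    KaehlerDifferential.D ℤ F (a ^ p * ∏ j, (y j : F) ^ m j) =
      (a ^ p * ∏ j, (y j : F) ^ m j) • ∑ j, (m j : F) • dlog (y j) := by
  have h : ∀ s : Finset (Fin n), KaehlerDifferential.D ℤ F (∏ j ∈ s, (y j : F) ^ m j) =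
      (∏ j ∈ s, (y j : F) ^ m j) • ∑ j ∈ s, (m j : F) • dlog (y j) := by
    intro s
    induction s using Finset.induction_on with
    | empty => simp
    | insert i s hi ih =>
      have h1 : KaehlerDifferential.D ℤ F ((y i : F) ^ m i) =
          ((y i : F) ^ m i * (m i : F)) • dlog (y i) := by
        rw [Derivation.leibniz_pow, ← Nat.cast_smul_eq_nsmul F, dlog, smul_smul, smul_smul]
        congr 1
        rcases Nat.eq_zero_or_pos (m i) with h0 | h0
        · simp [h0]
        · obtain ⟨k, hk⟩ := Nat.exists_eq_succ_of_ne_zero h0.ne'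
          have := (y i).ne_zero
          rw [hk, Nat.succ_sub_one, pow_succ]
          field_simp
      rw [Finset.prod_insert hi, Finset.sum_insert hi, Derivation.leibniz, ih, h1, smul_add,
        smul_smul, smul_smul, smul_smul, add_comm]
      congr 2
      ring
  rw [D_pow_char_mul, h Finset.univ, smul_smul]

end ExactForms

section CartierOnOneForms

variable (p : ℕ) [Fact p.Prime] {F : Type*} [Field F] [CharP F p] {n : ℕ}

/-- The form `y ^ (p - 1) dy`, a representative of the inverse Cartier operator on `dy`. -/
def invCartierD (y : F) : Ω[F⁄ℤ] := y ^ (p - 1) • KaehlerDifferential.D ℤ F y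

omit [CharP F p] in
lemma invCartierD_mul (y z : F) :
    invCartierD p (y * z) = y ^ p • invCartierD p z + z ^ p • invCartierD p y := by
  have hp : p = p - 1 + 1 := (Nat.succ_pred_prime Fact.out).symm
  rw [invCartierD, invCartierD, invCartierD, Derivation.leibniz, smul_add, smul_smul, smul_smul,
    smul_smul, smul_smul]
  congr 2
  · conv_rhs => rw [hp]
    simp only [Nat.add_sub_cancel]
    ring
  · conv_rhs => rw [hp]
    simp only [Nat.add_sub_cancel]
    ring

/-- `(1 + t) ^ (p - 1) dt - t ^ (p - 1) dt` is exact: as a polynomial in `t`, its coefficient has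
degree less than `p - 1` and so can be integrated. -/
lemma exists_invCartierD_add_one (t : F) :
    ∃ g : F, invCartierD p (t + 1) = invCartierD p t + KaehlerDifferential.D ℤ F g := by
  have hp : p = p - 1 + 1 := (Nat.succ_pred_prime Fact.out).symm
  refine ⟨∑ k ∈ Finset.range (p - 1),
    (((p - 1).choose k : ℕ) : F) * ((k + 1 : ℕ) : F)⁻¹ * t ^ (k + 1), ?_⟩
  have hD : ∀ k ∈ Finset.range (p - 1), KaehlerDifferential.D ℤ F
      ((((p - 1).choose k : ℕ) : F) * ((k + 1 : ℕ) : F)⁻¹ * t ^ (k + 1)) =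
      (t ^ k * (((p - 1).choose k : ℕ) : F)) • KaehlerDifferential.D ℤ F t := by
    intro k hk
    have hk' : ((k + 1 : ℕ) : F) ≠ 0 := by
      rw [Ne, CharP.cast_eq_zero_iff F p]
      intro h
      have := Nat.le_of_dvd k.succ_pos h
      have := Finset.mem_range.1 hk
      omega
    rw [Derivation.leibniz, Derivation.leibniz, Derivation.leibniz_inv, Derivation.map_natCast,
      Derivation.map_natCast, smul_zero, smul_zero, smul_zero, add_zero, smul_zero, add_zero,
      Derivation.leibniz_pow, ← Nat.cast_smul_eq_nsmul F, smul_smul, smul_smul]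
    congr 1
    rw [Nat.add_sub_cancel]
    field_simp
  rw [map_sum, Finset.sum_congr rfl hD, ← Finset.sum_smul, invCartierD, invCartierD, map_add,
    Derivation.map_one_eq_zero, add_zero, ← add_smul, add_pow, Finset.sum_range_succ]
  congr 1
  simp [add_comm]

lemma exists_invCartierD_add (y z : F) : ∃ g : F, invCartierD p (y + z) =
    invCartierD p y + invCartierD p z + KaehlerDifferential.D ℤ F g := by
  by_cases hy : y = 0
  · exact ⟨0, by simp [hy, invCartierD]⟩
  obtain ⟨g, hg⟩ := exists_invCartierD_add_one p (z * y⁻¹)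
  refine ⟨y ^ p * g, ?_⟩
  have h1 : y + z = y * (z * y⁻¹ + 1) := by field_simp; ring
  have h2 : z = y * (z * y⁻¹) := by field_simp
  conv_rhs => rw [h2]
  rw [h1, invCartierD_mul, invCartierD_mul, hg, add_pow_char, one_pow, D_pow_char_mul, add_smul,
    one_smul, smul_add]
  abel

variable {b : Fin n → F} (hb : IsPBasis p b)

/-- The Frobenius-semilinear map `∑ f_j dlog b_j ↦ ∑ f_j ^ p dlog b_j`. -/
def IsPBasis.invCartier : Ω[F⁄ℤ] →+ Ω[F⁄ℤ] where
  toFun ω := ∑ j, ((hb.dlogBasis p).repr ω j) ^ p • dlog (hb.unit p j)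
  map_zero' := by simp [(Fact.out : p.Prime).ne_zero]
  map_add' x y := by simp [add_pow_char, add_smul, Finset.sum_add_distrib]

lemma IsPBasis.invCartier_apply (ω : Ω[F⁄ℤ]) : hb.invCartier p ω =
    ∑ j, ((hb.dlogBasis p).repr ω j) ^ p • dlog (hb.unit p j) := rfl

lemma IsPBasis.invCartier_smul (c : F) (ω : Ω[F⁄ℤ]) :
    hb.invCartier p (c • ω) = c ^ p • hb.invCartier p ω := by
  simp only [IsPBasis.invCartier_apply, map_smul, Finsupp.smul_apply, smul_eq_mul, mul_pow,
    Finset.smul_sum, smul_smul]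

lemma IsPBasis.invCartier_dlog_unit (j : Fin n) :
    hb.invCartier p (dlog (hb.unit p j)) = dlog (hb.unit p j) := by
  rw [IsPBasis.invCartier_apply, ← hb.dlogBasis_apply p j, Module.Basis.repr_self,
    Finset.sum_eq_single j]
  · simp
  · intro k _ hk
    simp [hk.symm, (Fact.out : p.Prime).ne_zero]
  · simp

/-- The semilinear map sends `dy` to `y ^ (p - 1) dy` modulo exact forms: the `y` for which this
holds form a subsemiring, which contains `F ^ p` and the `p`-basis, and so is all of `F`. -/
theorem IsPBasis.exists_invCartier_D (y : F) : ∃ g : F,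
    hb.invCartier p (KaehlerDifferential.D ℤ F y) =
      invCartierD p y + KaehlerDifferential.D ℤ F g := by
  let T : Subsemiring F :=
    { carrier := {y | ∃ g : F, hb.invCartier p (KaehlerDifferential.D ℤ F y) =
        invCartierD p y + KaehlerDifferential.D ℤ F g}
      zero_mem' := ⟨0, by simp [invCartierD]⟩
      one_mem' := ⟨0, by simp [invCartierD]⟩
      add_mem' := by
        rintro x y ⟨g, hg⟩ ⟨h, hh⟩
        obtain ⟨k, hk⟩ := exists_invCartierD_add p x y
        refine ⟨g + h - k, ?_⟩
        rw [map_add, map_add, hg, hh, hk, map_sub, map_add]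
        abel
      mul_mem' := by
        rintro x y ⟨g, hg⟩ ⟨h, hh⟩
        refine ⟨x ^ p * h + y ^ p * g, ?_⟩
        rw [Derivation.leibniz, map_add, IsPBasis.invCartier_smul, IsPBasis.invCartier_smul, hg,
          hh, invCartierD_mul, map_add, D_pow_char_mul, D_pow_char_mul, smul_add, smul_add]
        abel }
  have hpow : ∀ x : F, x ^ p ∈ T := fun x => ⟨0, by
    rw [D_pow_char, invCartierD, D_pow_char]; simp⟩
  have hbT : ∀ j, b j ∈ T := fun j => by
    refine ⟨0, ?_⟩
    rw [map_zero, add_zero, invCartierD, hb.D_eq_smul_dlog p, hb.invCartier_smul,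
      hb.invCartier_dlog_unit, smul_smul, ← pow_succ, Nat.sub_add_cancel (Fact.out : p.Prime).pos]
  obtain ⟨a, rfl⟩ := hb.2 y
  exact (sum_mem fun I _ => mul_mem (hpow _) (prod_mem fun j _ => pow_mem (hbT j) _) :
    pExpand p b a ∈ T)

theorem IsPBasis.exists_invCartier_dlog (y : Fˣ) : ∃ g : F,
    dlog y = hb.invCartier p (dlog y) + KaehlerDifferential.D ℤ F g := by
  obtain ⟨g, hg⟩ := hb.exists_invCartier_D p (y : F)
  refine ⟨-((y : F)⁻¹ ^ p * g), ?_⟩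
  rw [dlog, IsPBasis.invCartier_smul, hg, invCartierD, map_neg, D_pow_char_mul, smul_add,
    add_neg_cancel_right, smul_smul]
  congr 1
  rw [inv_pow, pow_sub₀ _ y.ne_zero (Fact.out : p.Prime).one_le, pow_one,
    inv_mul_cancel_left₀ (pow_ne_zero _ y.ne_zero)]

end CartierOnOneForms

/-! ### The Cartier operator on top forms -/

section CartierRoot

variable (p : ℕ) [Fact p.Prime] {F : Type*} [Field F] [CharP F p] {n : ℕ}
  {b : Fin n → F} (hb : IsPBasis p b)

/-- The `p`-th root `a_0` of the constant term of the expansion `x = ∑_I a_I ^ p b ^ I` with respect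
to a `p`-basis. This is the Cartier operator on top forms, in the coordinate with respect to
`dlog b_1 ∧ ⋯ ∧ dlog b_n`. -/
def IsPBasis.root : F →+ F where
  toFun x := (Equiv.ofBijective _ hb).symm x 0
  map_zero' := by
    rw [(Equiv.symm_apply_eq _).2 (show (0 : F) = pExpand p b 0 from (pExpandₗ p b).map_zero.symm)]
    rfl
  map_add' x y := by
    obtain ⟨a, rfl⟩ := (Equiv.ofBijective _ hb).surjective x
    obtain ⟨c, rfl⟩ := (Equiv.ofBijective _ hb).surjective y
    rw [Equiv.symm_apply_apply, Equiv.symm_apply_apply, (Equiv.symm_apply_eq _).2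
      (show _ = pExpand p b (a + c) from (pExpand_add p b a c).symm)]
    rfl

lemma IsPBasis.root_pExpand (a : (Fin n → Fin p) → F) : hb.root p (pExpand p b a) = a 0 := by
  change (Equiv.ofBijective _ hb).symm (Equiv.ofBijective _ hb a) 0 = _
  rw [Equiv.symm_apply_apply]

lemma IsPBasis.root_pow_mul (c x : F) : hb.root p (c ^ p * x) = c * hb.root p x := by
  obtain ⟨a, rfl⟩ := hb.2 x
  rw [← pExpand_smul, hb.root_pExpand, hb.root_pExpand, Pi.smul_apply, smul_eq_mul]

lemma IsPBasis.root_one : hb.root p 1 = 1 := by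
  have h := pow_mul_monomial_eq p b 0 1
  simp only [one_pow, Pi.zero_apply, pow_zero, Finset.prod_const_one, mul_one,
    Nat.zero_div] at h
  have h1 := hb.root_pExpand p (Pi.single (modExponent p 0) 1)
  rwa [← h, show modExponent p (0 : Fin n → ℕ) = 0 from
    funext fun j => Fin.ext (by simp [modExponent]), Pi.single_eq_same] at h1

lemma IsPBasis.root_pow (c : F) : hb.root p (c ^ p) = c := by
  rw [← mul_one (c ^ p), hb.root_pow_mul, hb.root_one, mul_one]

lemma IsPBasis.root_monomial (a : F) (m : Fin n → ℕ) (hm : ∃ j, ¬ p ∣ m j) :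
    hb.root p (a ^ p * ∏ j, b j ^ m j) = 0 := by
  obtain ⟨j, hj⟩ := hm
  rw [pow_mul_monomial_eq, hb.root_pExpand, Pi.single_eq_of_ne]
  intro h
  refine hj (Nat.dvd_of_mod_eq_zero ?_)
  have := congrArg Fin.val (congrFun h j)
  simpa [modExponent] using this.symm

/-- The coordinate of a top form with respect to `dlog b_1 ∧ ⋯ ∧ dlog b_n`. -/
def IsPBasis.coord : AbsForms F n →ₗ[F] F :=
  exteriorPower.alternatingMapLinearEquiv (hb.dlogBasis p).det

lemma IsPBasis.coord_ιMulti (v : Fin n → Ω[F⁄ℤ]) :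
    hb.coord p (exteriorPower.ιMulti F n v) = (hb.dlogBasis p).det v :=
  exteriorPower.alternatingMapLinearEquiv_apply_ιMulti _ _

/-- The top form `dlog b_1 ∧ ⋯ ∧ dlog b_n`. -/
def IsPBasis.topForm : AbsForms F n := exteriorPower.ιMulti F n fun j => dlog (hb.unit p j)

lemma IsPBasis.coord_topForm : hb.coord p (hb.topForm p) = 1 := by
  rw [IsPBasis.topForm, hb.coord_ιMulti, ← funext (hb.dlogBasis_apply p)]
  exact (hb.dlogBasis p).det_self

lemma IsPBasis.coord_smul_topForm (ω : AbsForms F n) : hb.coord p ω • hb.topForm p = ω := by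
  have h : (LinearMap.toSpanSingleton F _ (hb.topForm p)).comp (hb.coord p) = LinearMap.id := by
    refine exteriorPower.linearMap_ext ?_
    refine Module.Basis.ext_alternating (hb.dlogBasis p) fun v hv => ?_
    let σ : Equiv.Perm (Fin n) := Equiv.ofBijective v (Finite.injective_iff_bijective.1 hv)
    have h1 : (fun i => hb.dlogBasis p (v i)) = (fun i => hb.dlogBasis p i) ∘ σ := rfl
    rw [h1, AlternatingMap.map_perm, AlternatingMap.map_perm]
    congr 1
    change hb.coord p (exteriorPower.ιMulti F n fun i => hb.dlogBasis p i) • hb.topForm p =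
      exteriorPower.ιMulti F n fun i => hb.dlogBasis p i
    simp only [hb.dlogBasis_apply]
    change hb.coord p (hb.topForm p) • hb.topForm p = hb.topForm p
    rw [hb.coord_topForm, one_smul]
  exact LinearMap.congr_fun h ω

/-- The Cartier operator kills the exact top forms. On the differentials of monomials in the
`p`-basis the coordinate is, up to a `p`-th power, a monomial `b ^ m` times the determinant of the
exponents. If all `m_j` are divisible by `p`, the rows of this matrix add up to zero. -/
theorem IsPBasis.root_coord_exact {ω : AbsForms F n} (hω : ω ∈ exactForms F n) :
    hb.root p (hb.coord p ω) = 0 := by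
  obtain _ | n := n
  · rw [show ω = 0 from hω, map_zero, map_zero]
  induction hω using AddSubgroup.closure_induction with
  | zero => rw [map_zero, map_zero]
  | add x y _ _ hx hy => rw [map_add, map_add, hx, hy, add_zero]
  | neg x _ hx => rw [map_neg, map_neg, hx, neg_zero]
  | mem x hx =>
    obtain ⟨x, rfl⟩ := hx
    choose a ha using fun i => hb.2 (x i)
    have hD : ∀ i, KaehlerDifferential.D ℤ F (x i) = ∑ I : Fin (n + 1) → Fin p,
        (a i I ^ p * ∏ j, b j ^ (I j : ℕ)) •
          ∑ j, ((I j : ℕ) : F) • dlog (hb.unit p j) := by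
      intro i
      rw [← ha i, pExpand, map_sum]
      exact Finset.sum_congr rfl fun I _ => D_monomial p (hb.unit p) (fun j => (I j : ℕ)) (a i I)
    rw [hb.coord_ιMulti]
    simp only [hD]
    rw [← AlternatingMap.coe_multilinearMap, MultilinearMap.map_sum, map_sum]
    refine Finset.sum_eq_zero fun r _ => ?_
    rw [MultilinearMap.map_smul_univ, AlternatingMap.coe_multilinearMap]
    set R : Matrix (Fin (n + 1)) (Fin (n + 1)) F := Matrix.of fun i j => ((r i j : ℕ) : F)
      with hR
    have hdet : (hb.dlogBasis p).det (fun i => ∑ j, ((r i j : ℕ) : F) • dlog (hb.unit p j)) =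
        R.det := by
      rw [Module.Basis.det_apply, ← Matrix.det_transpose]
      congr 1
      ext i j
      rw [Matrix.transpose_apply, Module.Basis.toMatrix_apply]
      simp only [← hb.dlogBasis_apply]
      rw [Module.Basis.repr_sum_self, hR, Matrix.of_apply]
    have hpow : R.det ^ p = R.det := by
      have := RingHom.map_det (frobenius F p) R
      rw [frobenius_def] at this
      rw [this]
      congr 1
      ext i j
      simp [hR]
    rw [hdet, smul_eq_mul]
    have hprod : (∏ i, (a i (r i) ^ p * ∏ j, b j ^ (r i j : ℕ))) * R.det =
        (R.det * ∏ i, a i (r i)) ^ p * ∏ j, b j ^ (∑ i, (r i j : ℕ)) := by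
      rw [Finset.prod_mul_distrib, Finset.prod_pow, Finset.prod_comm, mul_pow, hpow]
      simp only [Finset.prod_pow_eq_pow_sum]
      ring
    rw [hprod]
    by_cases hm : ∃ j, ¬ p ∣ ∑ i, (r i j : ℕ)
    · exact hb.root_monomial p _ _ hm
    · push Not at hm
      have h0 : R.det = 0 := by
        refine Matrix.exists_vecMul_eq_zero_iff.1 ⟨1, one_ne_zero, ?_⟩
        ext j
        rw [Matrix.vecMul, dotProduct]
        simp only [Pi.one_apply, one_mul, hR, Matrix.of_apply, Pi.zero_apply]
        rw [← Nat.cast_sum, (CharP.cast_eq_zero_iff F p _).2 (hm j)]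
      rw [h0, zero_mul, zero_pow (Fact.out : p.Prime).ne_zero, zero_mul, map_zero]

/-- A top form killed by the Cartier operator is exact. -/
theorem IsPBasis.exact_of_root_eq_zero {x : F} (hx : hb.root p x = 0) :
    x • hb.topForm p ∈ exactForms F n := by
  obtain ⟨a, rfl⟩ := hb.2 x
  rw [hb.root_pExpand] at hx
  rw [pExpand, Finset.sum_smul]
  refine sum_mem fun I _ => ?_
  by_cases hI : I = 0
  · rw [hI, hx, zero_pow (Fact.out : p.Prime).ne_zero, zero_mul, zero_smul]
    exact zero_mem _
  obtain ⟨j, hj⟩ := Function.ne_iff.1 hI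
  set κ : F := ((I j : ℕ) : F)⁻¹ with hκ
  have hIj : ((I j : ℕ) : F) ≠ 0 := by
    rw [Ne, CharP.cast_eq_zero_iff F p]
    intro h
    exact hj (Fin.ext (Nat.eq_zero_of_dvd_of_lt h (I j).2))
  have hκp : κ ^ p = κ := by
    rw [hκ, inv_pow]
    congr 1
    exact map_natCast (frobenius F p) _
  -- the form is the wedge of `d (κ a_I ^ p b ^ I)` with the `dlog b_k`, `k ≠ j`
  have h1 := ιMulti_update_D_mem_exactForms
    ((κ * a I) ^ p * ∏ j, (hb.unit p j : F) ^ (I j : ℕ)) (hb.unit p) j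
  rw [D_monomial, AlternatingMap.map_update_smul, AlternatingMap.map_update_sum,
    Finset.sum_eq_single j] at h1
  · rw [AlternatingMap.map_update_smul, Function.update_eq_self, smul_smul, mul_pow, hκp] at h1
    convert h1 using 2
    rw [hκ]
    simp only [IsPBasis.unit, Units.val_mk0]
    field_simp
    rfl
  · intro k _ hk
    rw [AlternatingMap.map_update_smul,
      (exteriorPower.ιMulti F n).map_update_self (fun k => dlog (hb.unit p k)) hk.symm, smul_zero]
  · simp

/-- The Cartier operator maps `x ^ p dlog y_1 ∧ ⋯ ∧ dlog y_n` to `x dlog y_1 ∧ ⋯ ∧ dlog y_n`. The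
factors `dlog y_i` are replaced one at a time by the `dlog b_j`: modulo exact forms, `dlog y_i` has
coordinates that are `p`-th powers. -/
theorem IsPBasis.root_coord_dlog (y : Fin n → Fˣ) (x : F) :
    hb.root p (hb.coord p (x ^ p • exteriorPower.ιMulti F n fun i => dlog (y i))) =
      x * hb.coord p (exteriorPower.ιMulti F n fun i => dlog (y i)) := by
  classical
  suffices H : ∀ (s : Finset (Fin n)) (y : Fin n → Fˣ),
      (∀ i, i ∉ s → ∃ j, y i = hb.unit p j) → ∀ x : F,
      hb.root p (hb.coord p (x ^ p • exteriorPower.ιMulti F n fun i => dlog (y i))) =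
        x * hb.coord p (exteriorPower.ιMulti F n fun i => dlog (y i)) from
    H Finset.univ y (fun i hi => absurd (Finset.mem_univ i) hi) x
  intro s
  induction s using Finset.induction_on with
  | empty =>
    intro y hy x
    choose σ hσ using fun i => hy i (Finset.notMem_empty i)
    set c := hb.coord p (exteriorPower.ιMulti F n fun i => dlog (y i)) with hc
    have hcp : c ^ p = c := by
      rw [hc, hb.coord_ιMulti, Module.Basis.det_apply, ← frobenius_def, RingHom.map_det]
      congr 1
      ext i j
      rw [RingHom.mapMatrix_apply, Matrix.map_apply, Module.Basis.toMatrix_apply, hσ,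
        ← hb.dlogBasis_apply, Module.Basis.repr_self, Finsupp.single_apply]
      split_ifs <;> simp
    rw [map_smul, ← hc, smul_eq_mul]
    conv_lhs => rw [← hcp]
    rw [← mul_pow, hb.root_pow]
  | insert i s hi ih =>
    intro y hy x
    obtain ⟨g, hg⟩ := hb.exists_invCartier_dlog p (y i)
    set f := (hb.dlogBasis p).repr (dlog (y i)) with hf
    have hself : exteriorPower.ιMulti F n (fun i => dlog (y i)) =
        exteriorPower.ιMulti F n
          (Function.update (fun i => dlog (y i)) i (dlog (y i))) := by
      rw [Function.update_eq_self]
    have hrepl : ∀ j, exteriorPower.ιMulti F n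
        (Function.update (fun i => dlog (y i)) i (dlog (hb.unit p j))) =
        exteriorPower.ιMulti F n
          (fun k => dlog (Function.update y i (hb.unit p j) k)) := by
      intro j
      congr 1
      ext k
      rcases eq_or_ne k i with rfl | hk
      · simp
      · simp [hk]
    have hih : ∀ (j : Fin n) (z : F), hb.root p (hb.coord p (z ^ p • exteriorPower.ιMulti F n
        (Function.update (fun i => dlog (y i)) i (dlog (hb.unit p j))))) =
        z * hb.coord p (exteriorPower.ιMulti F n
          (Function.update (fun i => dlog (y i)) i (dlog (hb.unit p j)))) := by
      intro j z
      rw [hrepl]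
      refine ih _ (fun k hk => ?_) z
      rcases eq_or_ne k i with rfl | hki
      · exact ⟨j, by simp⟩
      · simpa [hki] using hy k (by simp [hki, hk])
    have hexact := hb.root_coord_exact p
      (ιMulti_update_D_mem_exactForms (x ^ p * g) y i)
    have hL : x ^ p • exteriorPower.ιMulti F n (fun i => dlog (y i)) =
        (∑ j, (x * f j) ^ p • exteriorPower.ιMulti F n
          (Function.update (fun i => dlog (y i)) i (dlog (hb.unit p j)))) +
        exteriorPower.ιMulti F n (Function.update (fun i => dlog (y i)) i
          (KaehlerDifferential.D ℤ F (x ^ p * g))) := by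
      conv_lhs => rw [hself, hg]
      rw [hb.invCartier_apply, AlternatingMap.map_update_add, AlternatingMap.map_update_sum,
        D_pow_char_mul, AlternatingMap.map_update_smul, smul_add, Finset.smul_sum]
      simp only [AlternatingMap.map_update_smul, smul_smul, mul_pow, hf]
    have hR : exteriorPower.ιMulti F n (fun i => dlog (y i)) =
        ∑ j, f j • exteriorPower.ιMulti F n
          (Function.update (fun i => dlog (y i)) i (dlog (hb.unit p j))) := by
      conv_lhs => rw [hself, ← (hb.dlogBasis p).sum_repr (dlog (y i))]
      rw [AlternatingMap.map_update_sum]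
      simp only [AlternatingMap.map_update_smul, hb.dlogBasis_apply, hf]
    rw [hL, map_add, map_add, hexact, add_zero, map_sum, map_sum, hR, map_sum, Finset.mul_sum]
    refine Finset.sum_congr rfl fun j _ => ?_
    rw [hih, map_smul, smul_eq_mul, mul_assoc]

/-- In the top degree `n`, with `[F : F ^ p] = p ^ n`, the group `H_p^{n+1}(F)` is the cokernel of
`1 - C`, where `C` is the Cartier operator. -/
theorem IsPBasis.subsingleton_katoH_iff :
    Subsingleton (KatoH p F n) ↔ Function.Surjective fun s => s - hb.root p s := by
  constructor
  · intro h t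
    have htop : exactForms F n ⊔ artinSchreierForms p F n = ⊤ :=
      QuotientAddGroup.subsingleton_iff.1 h
    let C : AbsForms F n →+ F := (hb.root p).comp (hb.coord p).toAddMonoidHom
    let S : AddSubgroup F := (AddMonoidHom.id F - hb.root p).range
    have hlog : ∀ (x : F) (y : Fin n → Fˣ),
        C ((x - x ^ p) • exteriorPower.ιMulti F n fun i => dlog (y i)) ∈ S := by
      intro x y
      have h1 : ∀ ω : AbsForms F n, C ((x - x ^ p) • ω) = C (x • ω) - C (x ^ p • ω) := fun ω => by
        rw [eq_sub_iff_add_eq, ← map_add, ← add_smul, sub_add_cancel]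
      rw [h1]
      change hb.root p (hb.coord p _) - hb.root p (hb.coord p _) ∈ S
      rw [hb.root_coord_dlog, map_smul, smul_eq_mul]
      set z := x * hb.coord p (exteriorPower.ιMulti F n fun i => dlog (y i))
      refine ⟨-z, ?_⟩
      change -z - hb.root p (-z) = _
      rw [map_neg]
      ring
    have hle : exactForms F n ⊔ artinSchreierForms p F n ≤ S.comap C := by
      refine sup_le (fun ω hω => ?_) ((AddSubgroup.closure_le _).2 ?_)
      · change hb.root p (hb.coord p ω) ∈ S
        rw [hb.root_coord_exact p hω]
        exact zero_mem S
      · rintro _ ⟨x, y, rfl⟩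
        exact hlog x y
    have hmem : t ^ p • hb.topForm p ∈ S.comap C := hle (htop ▸ AddSubgroup.mem_top _)
    obtain ⟨s, hs⟩ := hmem
    refine ⟨s, ?_⟩
    change s - hb.root p s = hb.root p (hb.coord p (t ^ p • hb.topForm p)) at hs
    rw [map_smul, hb.coord_topForm, smul_eq_mul, mul_one, hb.root_pow] at hs
    exact hs
  · intro h
    refine QuotientAddGroup.subsingleton_iff.2 ?_
    rw [eq_top_iff]
    intro ω _
    rw [← hb.coord_smul_topForm p ω]
    set f := hb.coord p ω
    obtain ⟨s, hs⟩ := h (-hb.root p f)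
    have h1 : hb.root p (f - (s - s ^ p)) = 0 := by
      rw [map_sub, map_sub, hb.root_pow]
      change s - hb.root p s = _ at hs
      linear_combination hs
    have h2 : f • hb.topForm p =
        (f - (s - s ^ p)) • hb.topForm p + (s - s ^ p) • hb.topForm p := by
      rw [← add_smul, sub_add_cancel]
    rw [h2]
    exact AddSubgroup.add_mem_sup (hb.exact_of_root_eq_zero p h1)
      (AddSubgroup.subset_closure ⟨s, hb.unit p, rfl⟩)

end CartierRoot

/-! ### Purely inseparable extensions -/

section Naturality

variable (p : ℕ) [Fact p.Prime] {K L : Type*} [Field K] [Field L] [CharP K p] [CharP L p]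
  [Algebra K L] {n : ℕ}

omit [Fact p.Prime] [CharP K p] [CharP L p] in
lemma map_pExpand (b : Fin n → K) (a : (Fin n → Fin p) → K) :
    algebraMap K L (pExpand p b a) =
      pExpand p (fun j => algebraMap K L (b j)) fun I => algebraMap K L (a I) := by
  simp [pExpand]

/-- The Cartier root commutes with field extensions along which the `p`-basis stays a `p`-basis. -/
lemma IsPBasis.map_root {b : Fin n → K} (hb : IsPBasis p b)
    (hb' : IsPBasis p fun j => algebraMap K L (b j)) (x : K) :
    hb'.root p (algebraMap K L x) = algebraMap K L (hb.root p x) := by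
  obtain ⟨a, rfl⟩ := hb.2 x
  rw [map_pExpand, hb.root_pExpand, hb'.root_pExpand]

theorem subsingleton_katoH_of_bijective (h : Function.Bijective (algebraMap K L)) {d : ℕ}
    (hd : Module.finrank K (FrobTwist p K) = p ^ d) [hK : Subsingleton (KatoH p K d)] :
    Subsingleton (KatoH p L d) := by
  obtain ⟨n, b, hb⟩ := exists_isPBasis p (F := K)
    (by rw [hd]; exact pow_ne_zero _ (Fact.out : p.Prime).ne_zero)
  obtain rfl : n = d :=
    Nat.pow_right_injective (Fact.out : p.Prime).two_le (hb.finrank_eq.symm.trans hd)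
  have hb' : IsPBasis p fun j => algebraMap K L (b j) := by
    have h1 : (pExpand p fun j => algebraMap K L (b j)) ∘ (fun a I => algebraMap K L (a I)) =
        algebraMap K L ∘ pExpand p b := funext fun a => (map_pExpand p b a).symm
    have h2 : Function.Bijective fun (a : (Fin n → Fin p) → K) I => algebraMap K L (a I) :=
      h.comp_left
    exact (Function.Bijective.of_comp_iff _ h2).1 (h1 ▸ h.comp hb)
  rw [hb'.subsingleton_katoH_iff]
  intro t
  obtain ⟨t, rfl⟩ := h.2 t
  obtain ⟨s, rfl⟩ := (hb.subsingleton_katoH_iff p).1 hK t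
  exact ⟨algebraMap K L s, by simp only [map_sub, hb.map_root p hb']⟩

end Naturality

section InseparableStep

variable (p : ℕ) [Fact p.Prime] {M L : Type*} [Field M] [Field L] [CharP M p] [CharP L p]
  [Algebra M L]

/-- The heart of the inseparable step: let `(β, c)` be a `p`-basis of `L` such that `(β ^ p, c)` is
a `p`-basis of the subfield `M`. Then `L = M ⊕ M'` with `M' = ⊕_{0 < i < p} M β ^ i`; the Cartier
root of `L` kills `M'`, and on `M` it agrees with that of `M` modulo `M'`. -/
lemma surjective_sub_root_of_cons {e : ℕ} {β' : M} {c' : Fin e → M} {β : L}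
    (hβ : β ^ p = algebraMap M L β')
    (hbM : IsPBasis p (Fin.cons β' c' : Fin (e + 1) → M))
    (hbL : IsPBasis p (Fin.cons β fun j => algebraMap M L (c' j) : Fin (e + 1) → L))
    (hc : ∀ x, pExpand p (fun j => algebraMap M L (c' j)) x ∈ (algebraMap M L).range)
    (hc' : ∀ m, algebraMap M L m ∈ pRange p fun j => algebraMap M L (c' j))
    (h : Function.Surjective fun s => s - hbM.root p s) :
    Function.Surjective fun s => s - hbL.root p s := by
  set c : Fin e → L := fun j => algebraMap M L (c' j) with hcdef
  let S : AddSubgroup L := (AddMonoidHom.id L - hbL.root p).range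
  suffices hS : ∀ t, t ∈ S from hS
  have hmono : ∀ (w : L) (i : ℕ) (I : Fin e → ℕ),
      w ^ p * ∏ j, (Fin.cons β c : Fin (e + 1) → L) j ^ (Fin.cons i I : Fin (e + 1) → ℕ) j =
        w ^ p * (β ^ i * ∏ j, c j ^ I j) := by
    intro w i I
    simp [Fin.prod_univ_succ]
  -- the Cartier root kills `M β ^ i` for `0 < i < p`
  have hkill : ∀ (m : M) (i : ℕ), ¬ p ∣ i → hbL.root p (algebraMap M L m * β ^ i) = 0 := by
    intro m i hi
    obtain ⟨w, hw⟩ := hc' m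
    rw [← hw, pExpand, Finset.sum_mul, map_sum]
    refine Finset.sum_eq_zero fun I _ => ?_
    have h1 := hbL.root_monomial p (w I) (Fin.cons i fun j => (I j : ℕ)) ⟨0, by simpa using hi⟩
    rw [hmono] at h1
    rw [← h1]
    ring_nf
  have hM' : ∀ (m : M) (i : ℕ), ¬ p ∣ i → algebraMap M L m * β ^ i ∈ S := fun m i hi => by
    refine ⟨algebraMap M L m * β ^ i, ?_⟩
    change _ - hbL.root p _ = _
    rw [hkill m i hi, sub_zero]
    rfl
  have hM'2 : ∀ s : M, hbL.root p (algebraMap M L s) - algebraMap M L (hbM.root p s) ∈ S := by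
    intro s
    obtain ⟨a, rfl⟩ := hbM.2 s
    rw [pExpand, map_sum, map_sum, map_sum, map_sum, ← Finset.sum_sub_distrib]
    refine sum_mem fun J _ => ?_
    by_cases hJ : ∃ j : Fin e, J j.succ ≠ 0
    · -- both roots vanish
      obtain ⟨j, hj⟩ := hJ
      have hnd : ¬ p ∣ (J j.succ : ℕ) := fun hdvd =>
        hj (Fin.ext (Nat.eq_zero_of_dvd_of_lt hdvd (J j.succ).2))
      rw [hbM.root_monomial p _ _ ⟨j.succ, hnd⟩, map_zero, sub_zero]
      have h1 := hbL.root_monomial p (algebraMap M L (a J) * β ^ (J 0 : ℕ))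
        (Fin.cons 0 fun j => (J j.succ : ℕ)) ⟨j.succ, by simpa using hnd⟩
      rw [hmono] at h1
      convert zero_mem S
      rw [← h1]
      congr 1
      simp only [Fin.prod_univ_succ, Fin.cons_zero, Fin.cons_succ, map_mul, map_pow, map_prod,
        ← hβ, hcdef, pow_zero, one_mul, mul_pow]
      rw [← pow_mul, ← pow_mul, mul_comm p, mul_assoc]
    · push Not at hJ
      have hprod : a J ^ p * ∏ j, (Fin.cons β' c' : Fin (e + 1) → M) j ^ (J j : ℕ) =
          a J ^ p * β' ^ (J 0 : ℕ) := by
        simp [Fin.prod_univ_succ, hJ]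
      have hL : hbL.root p (algebraMap M L (a J ^ p * β' ^ (J 0 : ℕ))) =
          algebraMap M L (a J) * β ^ (J 0 : ℕ) := by
        rw [← hbL.root_pow p (algebraMap M L (a J) * β ^ (J 0 : ℕ)), map_mul, map_pow, map_pow,
          ← hβ, mul_pow, ← pow_mul, ← pow_mul, mul_comm p]
      rw [hprod, hL]
      by_cases h0 : J 0 = 0
      · rw [h0, Fin.val_zero, pow_zero, pow_zero, mul_one, mul_one, hbM.root_pow, sub_self]
        exact zero_mem S
      · have hnd : ¬ p ∣ (J 0 : ℕ) := fun hdvd =>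
          h0 (Fin.ext (Nat.eq_zero_of_dvd_of_lt hdvd (J 0).2))
        have h1 := hbM.root_monomial p (a J) (fun j => (J j : ℕ)) ⟨0, hnd⟩
        rw [hprod] at h1
        rw [h1, map_zero, sub_zero]
        exact hM' _ _ hnd
  have hM : ∀ m : M, algebraMap M L m ∈ S := by
    intro m
    obtain ⟨s, hs⟩ := h m
    have h1 : algebraMap M L s - hbL.root p (algebraMap M L s) ∈ S := ⟨algebraMap M L s, rfl⟩
    have h2 := add_mem h1 (hM'2 s)
    rw [sub_add_sub_cancel, ← map_sub] at h2
    rwa [← hs]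
  intro t
  obtain ⟨a, rfl⟩ := hbL.2 t
  rw [pExpand_cons]
  refine sum_mem fun i _ => ?_
  obtain ⟨m, hm⟩ := hc fun I => a (Fin.cons i I)
  rw [← hm]
  by_cases hi : p ∣ (i : ℕ)
  · rw [Nat.eq_zero_of_dvd_of_lt hi i.2, pow_zero, mul_one]
    exact hM m
  · exact hM' m i hi

/-- In top degree, the vanishing of `H_p^{d+1}` passes from `M` to `L = M(β)` with `β ^ p ∈ M`. A
`p`-basis `c` of `M` relative to `L ^ p ⊆ M` yields the `p`-bases `(β ^ p, c)` of `M` and `(β, c)` of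
`L`. -/
theorem subsingleton_katoH_of_adjoin_root {β : L} (hβ : β ^ p ∈ (algebraMap M L).range)
    (hβ' : β ∉ (algebraMap M L).range)
    (hgen : ∀ S : Subfield L, (algebraMap M L).fieldRange ≤ S → β ∈ S → S = ⊤)
    [FiniteDimensional M L] {d : ℕ} (hd : Module.finrank M (FrobTwist p M) = p ^ d)
    [hM : Subsingleton (KatoH p M d)] : Subsingleton (KatoH p L d) := by
  set E := (algebraMap M L).fieldRange with hEdef
  have hLd : Module.finrank L (FrobTwist p L) = p ^ d := (finrank_frobTwist_eq p M L).trans hd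
  have hp0 : p ^ d ≠ 0 := pow_ne_zero _ (Fact.out : p.Prime).ne_zero
  have hE : ∀ x : L, x ^ p ∈ E := by
    have := hgen (E.comap (frobenius L p)) (fun x hx => pow_mem hx p) hβ
    exact fun x => (this ▸ Subfield.mem_top x : x ∈ E.comap (frobenius L p))
  obtain ⟨e, c, hcE, hcinj, hcE'⟩ := exists_relative_pBasis p (hLd ▸ hp0) E hE
  have hbL : IsPBasis p (Fin.cons β c : Fin (e + 1) → L) := by
    refine ⟨injective_pExpand_cons p hcinj (hcE' ▸ hβ'), (pRange_eq_top p).1 (hgen _ ?_ ?_)⟩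
    · rw [← hcE']
      exact pRange_le p (pow_mem_pRange p _) fun j => by
        simpa using self_mem_pRange p (Fin.cons β c : Fin (e + 1) → L) j.succ
    · simpa using self_mem_pRange p (Fin.cons β c : Fin (e + 1) → L) 0
  obtain rfl : e + 1 = d :=
    Nat.pow_right_injective (Fact.out : p.Prime).two_le (hbL.finrank_eq.symm.trans hLd)
  choose c' hc' using hcE
  obtain ⟨β', hβ''⟩ := hβ
  have hbM : IsPBasis p (Fin.cons β' c' : Fin (e + 1) → M) := by
    refine isPBasis_of_surjective p ?_ hd
    set E' := (pRange p (Fin.cons β' c' : Fin (e + 1) → M)).map (algebraMap M L) with hE'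
    have h1 : E'.comap (frobenius L p) = ⊤ := by
      refine hgen _ ?_ ?_
      · rintro _ ⟨m, rfl⟩
        exact ⟨m ^ p, pow_mem_pRange p _ m, map_pow _ _ _⟩
      · exact ⟨β', by simpa using self_mem_pRange p (Fin.cons β' c' : Fin (e + 1) → M) 0, hβ''⟩
    have h2 : E ≤ E' := by
      rw [← hcE']
      refine pRange_le p (fun x => (h1 ▸ Subfield.mem_top x : x ∈ E'.comap (frobenius L p)))
        fun j => ⟨c' j, ?_, hc' j⟩
      simpa using self_mem_pRange p (Fin.cons β' c' : Fin (e + 1) → M) j.succ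
    intro m
    obtain ⟨m', hm', hmm⟩ := h2 (show algebraMap M L m ∈ E from ⟨m, rfl⟩)
    exact (algebraMap M L).injective hmm ▸ hm'
  obtain rfl : (fun j => algebraMap M L (c' j)) = c := funext hc'
  rw [hbL.subsingleton_katoH_iff]
  refine surjective_sub_root_of_cons p hβ''.symm hbM hbL (fun x => ?_) (fun m => ?_)
    ((hbM.subsingleton_katoH_iff p).1 hM)
  · have h1 : pExpand p (fun j => algebraMap M L (c' j)) x ∈ E := hcE' ▸ ⟨x, rfl⟩
    exact h1
  · rw [hcE']
    exact ⟨m, rfl⟩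

/-- In top degree, the vanishing of `H_p^{d+1}` passes to finite purely inseparable extensions. -/
theorem subsingleton_katoH_of_isPurelyInseparable.{u} (d : ℕ) (M L : Type u) [Field M] [Field L]
    [CharP M p] [CharP L p] [Algebra M L] [FiniteDimensional M L] [IsPurelyInseparable M L]
    (hd : Module.finrank M (FrobTwist p M) = p ^ d) [Subsingleton (KatoH p M d)] :
    Subsingleton (KatoH p L d) := by
  induction hn : Module.finrank M L using Nat.strong_induction_on generalizing M with
  | _ n ih =>
  by_cases hsurj : Function.Surjective (algebraMap M L)
  · exact subsingleton_katoH_of_bijective p ⟨(algebraMap M L).injective, hsurj⟩ hd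
  have hexp : ExpChar M p := ExpChar.prime Fact.out
  obtain ⟨x, hx⟩ : ∃ x : L, x ∉ (algebraMap M L).range := by
    by_contra! hcon
    exact hsurj hcon
  have hex : ∃ k, x ^ p ^ k ∈ (algebraMap M L).range := IsPurelyInseparable.pow_mem M p x
  classical
  obtain ⟨k, hk⟩ : ∃ k, Nat.find hex = k + 1 := by
    refine Nat.exists_eq_succ_of_ne_zero fun h0 => hx ?_
    have := Nat.find_spec hex
    rwa [h0, pow_zero, pow_one] at this
  set β := x ^ p ^ k with hβdef
  have hβ : β ^ p ∈ (algebraMap M L).range := by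
    have := Nat.find_spec hex
    rwa [hk, pow_succ, pow_mul] at this
  have hβ' : β ∉ (algebraMap M L).range := Nat.find_min hex (by omega)
  let N := IntermediateField.adjoin M {β}
  let γ : N := IntermediateField.AdjoinSimple.gen M β
  have hNchar : CharP N p := charP_of_injective_algebraMap (algebraMap M N).injective p
  have hN : Subsingleton (KatoH p N d) := by
    refine subsingleton_katoH_of_adjoin_root (M := M) p (β := γ) ?_ ?_ ?_ hd
    · obtain ⟨m, hm⟩ := hβ
      exact ⟨m, Subtype.ext hm⟩
    · rintro ⟨m, hm⟩
      exact hβ' ⟨m, congrArg Subtype.val hm⟩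
    · intro S hS hγ
      let S' : IntermediateField M N := S.toIntermediateField fun m => hS ⟨m, rfl⟩
      have h1 : N ≤ IntermediateField.lift S' :=
        IntermediateField.adjoin_simple_le_iff.2 ((IntermediateField.mem_lift γ).2 hγ)
      exact eq_top_iff.2 fun y _ => (IntermediateField.mem_lift (E := S') y).1 (h1 y.2)
  have hlt : Module.finrank N L < n := by
    have h1 := Module.finrank_mul_finrank M N L
    have h2 : 1 < Module.finrank M N := by
      rw [← not_le]
      intro hle
      have h3 : Module.finrank M N = 1 := le_antisymm hle Module.finrank_pos
      rw [IntermediateField.finrank_eq_one_iff, IntermediateField.adjoin_simple_eq_bot_iff] at h3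
      exact hβ' (IntermediateField.mem_bot.1 h3)
    have h4 : 0 < Module.finrank N L := Module.finrank_pos
    rw [← hn, ← h1]
    exact lt_mul_left h4 h2
  have hpi : IsPurelyInseparable N L := IsPurelyInseparable.tower_top M N L
  exact ih _ hlt N ((finrank_frobTwist_eq p M N).trans hd) rfl

end InseparableStep

/-! ### Separable extensions and dense subfields -/

section PBasisExtension

variable (p : ℕ) [Fact p.Prime] {K L : Type*} [Field K] [Field L] [CharP K p] [CharP L p]
  [Algebra K L] {n : ℕ}

lemma isPBasis_of_injective {b : Fin n → K} (hb : Function.Injective (pExpand p b))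
    (h : Module.finrank K (FrobTwist p K) = p ^ n) : IsPBasis p b := by
  have : Module.Finite K (FrobTwist p K) := Module.finite_of_finrank_pos
    (h ▸ pow_pos (Fact.out : p.Prime).pos n)
  exact ⟨hb, (LinearMap.injective_iff_surjective_of_finrank_eq_finrank
    (f := pExpandₗ p b) (by simp [h])).1 hb⟩

omit [Fact p.Prime] [CharP K p] [CharP L p] in
lemma injective_pExpand_of_map {b : Fin n → K}
    (hb : Function.Injective (pExpand p fun j => algebraMap K L (b j))) :
    Function.Injective (pExpand p b) := by
  intro x y hxy
  have h := hb ((map_pExpand p b x).symm.trans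
    ((congrArg (algebraMap K L) hxy).trans (map_pExpand p b y)))
  exact funext fun I => (algebraMap K L).injective (congrFun h I)

/-- A `p`-basis stays a `p`-basis in finite separable extensions, as `K(x) = K(x ^ p)` for
separable `x`. -/
theorem IsPBasis.map_of_isSeparable [FiniteDimensional K L] [Algebra.IsSeparable K L]
    {b : Fin n → K} (hb : IsPBasis p b) : IsPBasis p fun j => algebraMap K L (b j) := by
  refine isPBasis_of_surjective p ?_ ((finrank_frobTwist_eq p K L).trans hb.finrank_eq)
  intro x
  have hexp : ExpChar K p := ExpChar.prime Fact.out
  let E : IntermediateField K L := (pRange p fun j => algebraMap K L (b j)).toIntermediateField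
    fun k => by
      obtain ⟨a, rfl⟩ := hb.2 k
      exact ⟨_, (map_pExpand p b a).symm⟩
  have h1 : IntermediateField.adjoin K {x ^ p} ≤ E :=
    IntermediateField.adjoin_simple_le_iff.2 (pow_mem_pRange p _ x)
  have h2 := IntermediateField.adjoin_simple_eq_adjoin_pow_expChar_pow_of_isSeparable' K L x 1
    (q := p)
  rw [pow_one] at h2
  exact h1 (h2 ▸ IntermediateField.mem_adjoin_simple_self K x)

end PBasisExtension

section Density

variable (p : ℕ) [Fact p.Prime]

/-- A generating family over `K ^ p` also generates the completion: `𝕂 ^ p (b)` is a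
finite-dimensional, hence closed, subspace of `𝕂` over `𝕂 ^ p`, and contains the dense subfield
`K`. -/
theorem surjective_pExpand_of_denseRange {K 𝕂 : Type*} [Field K] [NontriviallyNormedField 𝕂]
    [CompleteSpace 𝕂] [CharP K p] [CharP 𝕂 p] [Algebra K 𝕂] (hd : DenseRange (algebraMap K 𝕂))
    {n : ℕ} {b : Fin n → K} (hb : Function.Surjective (pExpand p b)) :
    Function.Surjective (pExpand p fun j => algebraMap K 𝕂 (b j)) := by
  let i1 : TopologicalSpace (FrobTwist p 𝕂) := inferInstanceAs (TopologicalSpace 𝕂)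
  have i2 : IsTopologicalAddGroup (FrobTwist p 𝕂) := inferInstanceAs (IsTopologicalAddGroup 𝕂)
  have i3 : T2Space (FrobTwist p 𝕂) := inferInstanceAs (T2Space 𝕂)
  have i4 : ContinuousSMul 𝕂 (FrobTwist p 𝕂) := by
    constructor
    change Continuous fun x : 𝕂 × 𝕂 => x.1 ^ p * x.2
    fun_prop
  have hclosed := Submodule.closed_of_finiteDimensional
    (LinearMap.range (pExpandₗ p fun j => algebraMap K 𝕂 (b j)))
  have hcl : IsClosed (Set.range (pExpand p fun j => algebraMap K 𝕂 (b j))) := hclosed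
  have hsub : Set.range (algebraMap K 𝕂) ⊆
      Set.range (pExpand p fun j => algebraMap K 𝕂 (b j)) := by
    rintro _ ⟨x, rfl⟩
    obtain ⟨a, rfl⟩ := hb x
    exact ⟨_, (map_pExpand p b a).symm⟩
  intro x
  exact hcl.closure_subset_iff.2 hsub (hd x)

/-- If `1 - C` is surjective on a dense subfield with the same `p`-basis, it is surjective on a
complete field: for `‖ε‖ < 1` the element `h = ∑_k ε ^ (p ^ k)` satisfies `h = ε + h ^ p`, so that
`ε = (1 - C) (-h ^ p)`. -/
theorem surjective_sub_root_of_denseRange {K 𝕂 : Type*} [Field K] [NormedField 𝕂]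
    [CompleteSpace 𝕂] [CharP K p] [CharP 𝕂 p] [Algebra K 𝕂] (hd : DenseRange (algebraMap K 𝕂))
    {n : ℕ} {b : Fin n → K} (hb : IsPBasis p b) (hb' : IsPBasis p fun j => algebraMap K 𝕂 (b j))
    (h : Function.Surjective fun s => s - hb.root p s) :
    Function.Surjective fun s => s - hb'.root p s := by
  intro t
  obtain ⟨x, hx⟩ := hd.exists_dist_lt t one_pos
  obtain ⟨s, hs⟩ := h x
  set ε := t - algebraMap K 𝕂 x with hε
  have hε1 : ‖ε‖ < 1 := by rwa [hε, ← dist_eq_norm]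
  have hsum : Summable fun k : ℕ => ε ^ p ^ k := by
    refine Summable.of_norm_bounded (summable_geometric_of_lt_one (norm_nonneg ε) hε1) fun k => ?_
    rw [norm_pow]
    exact pow_le_pow_of_le_one (norm_nonneg ε) hε1.le
      (Nat.lt_pow_self (Fact.out : p.Prime).one_lt).le
  set f := ∑' k : ℕ, ε ^ p ^ k with hf
  have hfix : f = ε + f ^ p := by
    have h1 : HasSum (fun k : ℕ => (ε ^ p ^ k) ^ p) (f ^ p) :=
      hsum.hasSum.map (frobenius 𝕂 p) (by
        change Continuous fun x : 𝕂 => x ^ p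
        fun_prop)
    rw [← h1.tsum_eq, hf, hsum.tsum_eq_zero_add, pow_zero, pow_one]
    simp only [pow_succ, pow_mul]
  refine ⟨algebraMap K 𝕂 s - f ^ p, ?_⟩
  have h2 : algebraMap K 𝕂 s - algebraMap K 𝕂 (hb.root p s) = algebraMap K 𝕂 x := by
    rw [← map_sub]
    exact congrArg _ hs
  simp only [map_sub, hb'.root_pow, hb.map_root p hb']
  linear_combination h2 + hfix

open Polynomial in
/-- A finite separable extension of a complete field is generated by an element that is algebraic
over a given dense subfield. By Krasner's lemma, this is a root close to a primitive element of a
polynomial over the dense subfield close to the minimal polynomial. -/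
theorem exists_adjoin_eq_top_of_denseRange {K 𝕂 M : Type*} [Field K] [NontriviallyNormedField 𝕂]
    [CompleteSpace 𝕂] [IsUltrametricDist 𝕂] [Algebra K 𝕂] (hd : DenseRange (algebraMap K 𝕂))
    [Field M] [Algebra 𝕂 M] [Algebra K M] [IsScalarTower K 𝕂 M] [FiniteDimensional 𝕂 M]
    [Algebra.IsSeparable 𝕂 M] :
    ∃ β : M, IsIntegral K β ∧ IntermediateField.adjoin 𝕂 {β} = ⊤ := by
  obtain ⟨α, hα⟩ := Field.exists_primitive_element 𝕂 M
  have hαint : IsIntegral 𝕂 α := Algebra.IsIntegral.isIntegral α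
  let F := AlgebraicClosure M
  have halg : Algebra.IsAlgebraic 𝕂 F := Algebra.IsAlgebraic.trans 𝕂 M F
  let : NormedField F := spectralNorm.normedField 𝕂 F
  let : NormedAlgebra 𝕂 F := spectralNorm.normedAlgebra 𝕂 F
  set a : F := algebraMap M F α with ha
  set f := minpoly 𝕂 α with hf
  have hfa : minpoly 𝕂 a = f := minpoly.algebraMap_eq (algebraMap M F).injective α
  have fa0 : f.aeval a = 0 := hfa ▸ minpoly.aeval 𝕂 a
  have fmon : f.Monic := minpoly.monic hαint
  have haint : IsIntegral 𝕂 a := hαint.algebraMap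
  have fdeg0 : f.natDegree ≠ 0 := (minpoly.natDegree_pos hαint).ne'
  -- a lower bound for the distance of `a` to its other conjugates
  obtain ⟨δ, δpos, hδ⟩ : ∃ δ : ℝ, 0 < δ ∧ ∀ a' : F, IsConjRoot 𝕂 a a' → a ≠ a' → δ ≤ ‖a - a'‖ := by
    classical
    have hfin : (f.rootSet F \ {a}).Finite := (f.rootSet_finite F).sdiff
    rcases (f.rootSet F \ {a}).eq_empty_or_nonempty with h0 | hne
    · refine ⟨1, one_pos, fun a' ha' hne => ?_⟩
      have : a' ∈ f.rootSet F \ {a} :=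
        ⟨hfa ▸ (isConjRoot_iff_mem_minpoly_rootSet haint).1 ha', hne.symm⟩
      rw [h0] at this
      exact this.elim
    · obtain ⟨x, hx, hmin⟩ := hfin.exists_minimalFor (fun x => ‖a - x‖) _ hne
      refine ⟨‖a - x‖, norm_pos_iff.2 (sub_ne_zero.2 (Ne.symm hx.2)), fun a' ha' hne => ?_⟩
      have hmem : a' ∈ f.rootSet F \ {a} :=
        ⟨hfa ▸ (isConjRoot_iff_mem_minpoly_rootSet haint).1 ha', hne.symm⟩
      rcases le_total ‖a - x‖ ‖a - a'‖ with h1 | h1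
      · exact h1
      · exact hmin hmem h1
  have hε : (δ / (max ‖a‖ 1)) ^ f.natDegree / (f.natDegree + 1) > 0 := by positivity
  obtain ⟨g, gmon, gdeg, gcoeff⟩ :=
    exists_monic_and_natDegree_eq_and_norm_map_algebraMap_coeff_sub_lt hd fmon hε
  obtain ⟨β, hβ, hab⟩ := exists_aroots_norm_sub_lt_of_norm_coeff_sub_lt
    hε fa0 fmon (gmon.map _) (gdeg ▸ (g.natDegree_map _)) gcoeff (IsAlgClosed.splits _)
  have hab : ‖a - β‖ < δ := by
    rw [← Real.rpow_natCast, ← mul_comm_div, div_self, one_mul,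
        ← Real.rpow_mul (div_pos δpos (by positivity)).le, mul_inv_cancel₀] at hab
    · simpa [mul_assoc, div_mul_cancel₀ _ (by positivity : (max ‖a‖ 1) > 0).ne'] using hab
    · simp [fdeg0]
    · positivity
  have hβ0 : aeval β (g.map (algebraMap K 𝕂)) = 0 := (mem_aroots.1 hβ).2
  have hβint : IsIntegral 𝕂 β := ⟨_, gmon.map _, hβ0⟩
  have hmem : a ∈ IntermediateField.adjoin 𝕂 {β} :=
    IsKrasner.krasner (K := 𝕂) (hfa ▸ Algebra.IsSeparable.isSeparable 𝕂 α)
      (IsAlgClosed.splits _) hβint fun a' h1 h2 => lt_of_lt_of_le hab (hδ a' h1 h2)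
  have hfd : FiniteDimensional 𝕂 (IntermediateField.adjoin 𝕂 {β}) :=
    IntermediateField.adjoin.finiteDimensional hβint
  -- comparing degrees, `𝕂(a) = 𝕂(β)`
  have heq : IntermediateField.adjoin 𝕂 {a} = IntermediateField.adjoin 𝕂 {β} := by
    refine IntermediateField.eq_of_le_of_finrank_le
      (IntermediateField.adjoin_simple_le_iff.2 hmem) ?_
    rw [IntermediateField.adjoin.finrank hβint, IntermediateField.adjoin.finrank haint, hfa,
      gdeg, ← g.natDegree_map (algebraMap K 𝕂)]
    exact natDegree_le_natDegree (minpoly.min 𝕂 β (gmon.map _) hβ0)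
  have hmap : (IntermediateField.adjoin 𝕂 {α}).map (IsScalarTower.toAlgHom 𝕂 M F) =
      IntermediateField.adjoin 𝕂 {β} := by
    rw [IntermediateField.adjoin_map, Set.image_singleton, ← heq]
    rfl
  obtain ⟨β', -, hβ'⟩ : β ∈ (IntermediateField.adjoin 𝕂 {α}).map (IsScalarTower.toAlgHom 𝕂 M F) :=
    hmap ▸ IntermediateField.mem_adjoin_simple_self 𝕂 β
  have hβ'' : algebraMap M F β' = β := hβ'
  refine ⟨β', ⟨g, gmon, (algebraMap M F).injective ?_⟩, ?_⟩
  · rw [map_zero, ← hβ0, ← hβ'', aeval_map_algebraMap, aeval_algebraMap_apply]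
    rfl
  · have h3 : (IntermediateField.adjoin 𝕂 {β'}).map (IsScalarTower.toAlgHom 𝕂 M F) =
        (IntermediateField.adjoin 𝕂 {α}).map (IsScalarTower.toAlgHom 𝕂 M F) := by
      rw [hmap, IntermediateField.adjoin_map, Set.image_singleton]
      exact congrArg (fun z => IntermediateField.adjoin 𝕂 {z}) hβ'
    rw [← hα]
    exact IntermediateField.map_injective _ h3

end Density

/-! ### Comparison of a field with its completion -/

section Comparison

variable (p : ℕ) [Fact p.Prime]

/-- The top-degree case of the descent to separable extensions of the completion: a finite separable
extension `M` of `𝕂` contains a dense subfield `K'` that is finite over `K`, and the `p`-basis of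
`K` is a `p`-basis of both `K'` and `M`. -/
theorem subsingleton_katoH_of_isSeparable {K 𝕂 M : Type*} [Field K] [NontriviallyNormedField 𝕂]
    [CompleteSpace 𝕂] [IsUltrametricDist 𝕂] [CharP K p] [CharP 𝕂 p] [Algebra K 𝕂]
    (hd : DenseRange (algebraMap K 𝕂)) [Field M] [CharP M p] [Algebra 𝕂 M] [Algebra K M]
    [IsScalarTower K 𝕂 M] [FiniteDimensional 𝕂 M] [Algebra.IsSeparable 𝕂 M]
    {n : ℕ} {b : Fin n → K} (hb : Function.Surjective (pExpand p b))
    (hb' : IsPBasis p fun j => algebraMap K 𝕂 (b j))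
    (hK : ∀ (K' : IntermediateField K M) [FiniteDimensional K K'], Subsingleton (KatoH p K' n)) :
    Subsingleton (KatoH p M n) := by
  obtain ⟨β, hβ, htop⟩ := exists_adjoin_eq_top_of_denseRange (M := M) hd
  let : NormedField M := spectralNorm.normedField 𝕂 M
  let : NormedAlgebra 𝕂 M := spectralNorm.normedAlgebra 𝕂 M
  have hcomp : CompleteSpace M := FiniteDimensional.complete 𝕂 M
  let K' := IntermediateField.adjoin K {β}
  have hfd : FiniteDimensional K K' := IntermediateField.adjoin.finiteDimensional hβ
  have hchar : CharP K' p := charP_of_injective_algebraMap (algebraMap K K').injective p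
  have hbK : IsPBasis p b := ⟨injective_pExpand_of_map p hb'.1, hb⟩
  have hbM : IsPBasis p fun j => algebraMap 𝕂 M (algebraMap K 𝕂 (b j)) :=
    hb'.map_of_isSeparable p
  have hbM' : IsPBasis p fun j => algebraMap K' M (algebraMap K K' (b j)) := by
    have h1 : (fun j => algebraMap K' M (algebraMap K K' (b j))) =
        fun j => algebraMap 𝕂 M (algebraMap K 𝕂 (b j)) := funext fun j => by
      rw [← IsScalarTower.algebraMap_apply, ← IsScalarTower.algebraMap_apply]
    exact h1 ▸ hbM
  have hbK' : IsPBasis p fun j => algebraMap K K' (b j) :=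
    isPBasis_of_injective p (injective_pExpand_of_map p hbM'.1)
      ((finrank_frobTwist_eq p K K').trans hbK.finrank_eq)
  have hdense : DenseRange (algebraMap K' M) := by
    let R : Subring M := K'.toSubring.topologicalClosure
    have h𝕂 : ∀ x : 𝕂, algebraMap 𝕂 M x ∈ R := by
      intro x
      have hc : Continuous (algebraMap 𝕂 M) := continuous_algebraMap 𝕂 M
      have h1 : algebraMap 𝕂 M x ∈ closure (algebraMap 𝕂 M '' Set.range (algebraMap K 𝕂)) :=
        image_closure_subset_closure_image hc ⟨x, hd x, rfl⟩
      refine closure_mono ?_ h1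
      rintro _ ⟨_, ⟨k, rfl⟩, rfl⟩
      rw [← IsScalarTower.algebraMap_apply]
      exact K'.algebraMap_mem k
    let A : Subalgebra 𝕂 M := { R with algebraMap_mem' := h𝕂 }
    have hA : Algebra.adjoin 𝕂 {β} ≤ A := by
      refine Algebra.adjoin_le (Set.singleton_subset_iff.2 ?_)
      exact subset_closure (IntermediateField.mem_adjoin_simple_self K β)
    intro x
    have hx : x ∈ Algebra.adjoin 𝕂 {β} := by
      rw [← IntermediateField.adjoin_simple_toSubalgebra_of_isAlgebraic
        (Algebra.IsAlgebraic.isAlgebraic β), htop]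
      trivial
    have h2 : x ∈ closure (K' : Set M) := hA hx
    have h3 : Set.range (algebraMap K' M) = (K' : Set M) := Subtype.range_coe
    rw [h3]
    exact h2
  rw [hbM'.subsingleton_katoH_iff]
  exact surjective_sub_root_of_denseRange p hdense hbK' hbM'
    ((hbK'.subsingleton_katoH_iff p).1 (hK K'))

/-- The conditions defining `dim_p ≤ d` pass from a field to its completion. -/
theorem subsingleton_of_denseRange.{u} {K 𝕂 : Type u} [Field K] [NontriviallyNormedField 𝕂]
    [CompleteSpace 𝕂] [IsUltrametricDist 𝕂] [CharP K p] [CharP 𝕂 p] [Algebra K 𝕂]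
    (hd : DenseRange (algebraMap K 𝕂)) (d : ℕ) [Subsingleton (AbsForms K (d + 1))]
    (hK : ∀ (K' : Type u) [Field K'] [Algebra K K'] [FiniteDimensional K K'],
      Subsingleton (KatoH p K' d)) :
    Subsingleton (AbsForms 𝕂 (d + 1)) ∧
      ∀ (L : Type u) [Field L] [Algebra 𝕂 L] [FiniteDimensional 𝕂 L],
        Subsingleton (KatoH p L d) := by
  obtain ⟨e, hed, b, hb⟩ := exists_surjective_pExpand_of_subsingleton (F := K) p d
  have hb' := surjective_pExpand_of_denseRange p hd hb
  refine ⟨subsingleton_absForms p hb' (by omega), fun L _ _ _ => ?_⟩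
  have hL : CharP L p := charP_of_injective_algebraMap (algebraMap 𝕂 L).injective p
  have h0 := finrank_ne_zero_of_surjective p hb'
  have hLfin := finrank_frobTwist_eq p 𝕂 L
  obtain ⟨n, c, hc⟩ := exists_isPBasis p (F := L) (hLfin ▸ h0)
  have hne : n ≤ e := by
    have h1 := finrank_le_of_surjective p hb'
    rw [← hLfin, hc.finrank_eq] at h1
    exact (Nat.pow_le_pow_iff_right (Fact.out : p.Prime).one_lt).1 h1
  rcases lt_or_eq_of_le (hne.trans hed) with hlt | rfl
  · -- there are no forms of degree `d` on `L` if `[L : L ^ p] < p ^ d`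
    have := subsingleton_absForms p hc.2 hlt
    exact (QuotientAddGroup.mk_surjective
      (s := exactForms L d ⊔ artinSchreierForms p L d)).subsingleton
  obtain rfl : e = n := le_antisymm hed hne
  have hb'' : IsPBasis p fun j => algebraMap K 𝕂 (b j) :=
    isPBasis_of_surjective p hb' (hLfin.symm.trans hc.finrank_eq)
  let M := separableClosure 𝕂 L
  have hM : CharP M p := charP_of_injective_algebraMap (algebraMap 𝕂 M).injective p
  let : Algebra K M := ((algebraMap 𝕂 M).comp (algebraMap K 𝕂)).toAlgebra
  have : IsScalarTower K 𝕂 M := IsScalarTower.of_algebraMap_eq fun _ => rfl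
  have hKM : Subsingleton (KatoH p M e) :=
    subsingleton_katoH_of_isSeparable p hd hb hb'' fun K' _ => hK K'
  exact subsingleton_katoH_of_isPurelyInseparable p e M L
    ((finrank_frobTwist_eq p 𝕂 M).trans hb''.finrank_eq)

end Comparison

/-! ### Completions of discrete valuations -/

section ValuedCompletion

/-- The extension of a discrete valuation to the completion has the same value group. -/
theorem isRankOneDiscrete_completion {K : Type*} [Field K] {Γ₀ : Type*}
    [LinearOrderedCommGroupWithZero Γ₀] (v : Valuation K Γ₀) [hv : v.IsRankOneDiscrete] :
    (Valued.v : Valuation v.Completion Γ₀).IsRankOneDiscrete where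
  exists_generator_lt_one' := by
    obtain ⟨γ, hγ, hγ1⟩ := hv.exists_generator_lt_one'
    refine ⟨γ, ?_, hγ1⟩
    rw [hγ, MonoidWithZeroHom.valueGroup_def, MonoidWithZeroHom.valueGroup_def]
    congr 1
    ext g
    change (∃ x, v x = g) ↔ ∃ x, (Valued.v : Valuation v.Completion Γ₀) x = g
    constructor
    · rintro ⟨x, hx⟩
      exact ⟨_, (Valued.valuedCompletion_apply (WithVal.toVal v x)).trans hx⟩
    · rintro ⟨x, hx⟩
      obtain ⟨r, hr⟩ := Valued.exists_coe_eq_v x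
      exact ⟨r.ofVal, hr.symm.trans hx⟩

end ValuedCompletion

end

theorem mainTheorem9 (p : ℕ) [Fact p.Prime] (K : Type*) [Field K] [CharP K p]
    {Γ₀ : Type*} [LinearOrderedCommGroupWithZero Γ₀]
    (v : Valuation K Γ₀) [v.IsRankOneDiscrete] :
    pDim p K ≥ pDim p v.Completion := by
  have hdisc := isRankOneDiscrete_completion v
  let : (Valued.v : Valuation v.Completion Γ₀).RankOne :=
    Valuation.IsRankOneDiscrete.rankOne _ one_lt_two
  let : NontriviallyNormedField v.Completion := Valued.toNontriviallyNormedField v.Completion Γ₀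
  have : IsUltrametricDist v.Completion := inferInstance
  let f : K →+* v.Completion :=
    (UniformSpace.Completion.coeRingHom (α := WithVal v)).comp (WithVal.equiv v).symm.toRingHom
  let : Algebra K v.Completion := f.toAlgebra
  have hd : DenseRange (algebraMap K v.Completion) :=
    (UniformSpace.Completion.denseRange_coe (α := WithVal v)).comp
      (WithVal.equiv v).symm.surjective.denseRange (UniformSpace.Completion.continuous_coe _)
  have : CharP v.Completion p :=
    charP_of_injective_algebraMap (algebraMap K v.Completion).injective p
  refine sInf_le_sInf ?_
  rintro _ ⟨d, rfl, h1, h2⟩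
  obtain ⟨h3, h4⟩ := subsingleton_of_denseRange p hd d h2
  exact ⟨d, rfl, h3, h4⟩
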